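/- Setting. Let $G^*=\{G^*_1,\dots,G^*_K\}$ be a partition of $[p]=\{1,\dots,p\}$ into $K\ge 2$ groups, and let $m=\min_k|G^*_k|\ge 3$ be the size of the smallest group. Let $X=(X_1,\dots,X_p)$ be a Gaussian vector with a latent decomposition with respect to $G^*$: $X_a=Z_k+E_a$ for all $a\in G^*_k$ and all $k$, where $Z=(Z_1,\dots,Z_K)$ is a centered, square-integrable latent vector independent of the centered, square-integrable error vector $E=(E_1,\dots,E_p)$, and $E$ has independent entries with variances equal within each group. Let $C^*=\mathrm{Cov}(Z)$, $\Gamma=\mathrm{Cov}(E)$ (a diagonal matrix), $|\Gamma|_\infty=\max_{a,b}|\Gamma_{ab}|$, and assume $\Delta(C^*)=\min_{j<k}(C^*_{jj}+C^*_{kk}-2C^*_{jk})>0$. We observe i.i.d. copies $X^{(1)},\dots,X^{(n)}$ of $X$, stacked as the rows of the $n\times p$ matrix $\mathbf X$ with columns $\mathbf X_{:a}$. Let $B^*\in\mathbb R^{p\times p}$ have entries $B^*_{ab}=1/|G^*_k|$ if $a,b$ both belong to $G^*_k$, and $B^*_{ab}=0$ if $a,b$ are in different groups. PECOK (with $K$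 known). Step 1: for $a,b\in[p]$ put $$V(a,b)=\max_{c,d\in[p]\setminus\{a,b\}}\Big|\Big\langle \mathbf X_{:a}-\mathbf X_{:b},\frac{\mathbf X_{:c}-\mathbf X_{:d}}{|\mathbf X_{:c}-\mathbf X_{:d}|_2}\Big\rangle\Big|\qquad(0/0=0),$$ let $ne_1(a)\in\operatorname{argmin}_{b\ne a}V(a,b)$ and $ne_2(a)\in\operatorname{argmin}_{b\notin\{a,ne_1(a)\}}V(a,b)$ (ties broken arbitrarily), and let $\widehat\Gamma$ be the diagonal matrix with entries $\widehat\Gamma_{aa}=\frac1n\langle \mathbf X_{:a}-\mathbf X_{:ne_1(a)},\mathbf X_{:a}-\mathbf X_{:ne_2(a)}\rangle$. Step 2: with $\widehat\Sigma=\frac1n\mathbf X^t\mathbf X$ and $\langle\cdot,\cdot\rangle$ the Frobenius scalar product, let $\widehat B$ be a maximizer of $\langle\widehat\Sigma-\widehat\Gamma,B\rangle$ over the set $\mathcal C$ of symmetric positive semidefinite $B\in\mathbb R^{p\times p}$ with $B_{ab}\ge0$ for all $a,b$, $\sum_aB_{ab}=1$ for all $b$, and $\mathrm{tr}(B)=K$.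 Step 3: let $\widehat G$ be the output on $\widehat B$ of a (possibly randomized) clustering algorithm, the only requirement on which is that it almost surely returns $G^*$ when applied to $B^*$. Claim. There exist three positive numerical constants $c_1,c_2,c_3$ such that, in every such setting, if $\log p\le c_1 n$ and $$\Delta(C^*)\ \ge\ c_2\,|\Gamma|_\infty\left\{\sqrt{\frac{\log p}{mn}}+\sqrt{\frac{p}{nm^2}}+\frac{\log p}{n}+\frac{p}{nm}\right\},$$ then $\widehat B=B^*$ with probability at least $1-c_3/p$, and moreover $\widehat G=G^*$ with probability at least $1-c_3/p$. -/

import Mathlib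

open MeasureTheory ProbabilityTheory Matrix

noncomputable section

namespace Pecok

/-- The covariance matrix of a random vector `Y`. -/
def covMatrix {Ω ι : Type*} [MeasurableSpace Ω] (Y : Ω → ι → ℝ) (P : Measure Ω) :
    Matrix ι ι ℝ :=
  Matrix.of fun i j => cov[fun ω => Y ω i, fun ω => Y ω j; P]

/-- The entrywise sup norm of a matrix. -/
def supNorm {ι κ : Type*} (M : Matrix ι κ ℝ) : ℝ :=
  ⨆ ij : ι × κ, |M ij.1 ij.2|

/-- The Frobenius scalar product. -/
def frob {ι : Type*} [Fintype ι] (M N : Matrix ι ι ℝ) : ℝ :=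
  ∑ a, ∑ b, M a b * N a b

/-- A partition of `[p] = Fin p` into (nonempty) groups. -/
abbrev Partition (p : ℕ) := Finpartition (Finset.univ : Finset (Fin p))

/-- The group of `a`, as an element of the set of groups. -/
def group {p : ℕ} (G : Partition p) (a : Fin p) : G.parts :=
  ⟨G.part a, G.part_mem.2 (Finset.mem_univ a)⟩

/-- The size of the smallest group. -/
def minSize {p : ℕ} (G : Partition p) : ℕ :=
  ⨅ g : G.parts, (g : Finset (Fin p)).card

/-- `X₀` has a latent decomposition with respect to `G`: `X_a = Z_k + E_a` for all `a ∈ G_k`, where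
`Z` (indexed by the groups) is centered, independent of the centered vector `E`, and `E` has
independent entries whose variances are equal within each group. -/
structure LatentDecomposition {p : ℕ} {Ω : Type*} [MeasurableSpace Ω] (P : Measure Ω)
    (G : Partition p) (X₀ : Ω → Fin p → ℝ) (Z : Ω → G.parts → ℝ) (E : Ω → Fin p → ℝ) : Prop where
  eq_add : ∀ᵐ ω ∂P, ∀ a, X₀ ω a = Z ω (group G a) + E ω a
  memLp_latent : ∀ k, MemLp (fun ω => Z ω k) 2 P
  memLp_error : ∀ a, MemLp (fun ω => E ω a) 2 P
  mean_latent : ∀ k, ∫ ω, Z ω k ∂P = 0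
  mean_error : ∀ a, ∫ ω, E ω a ∂P = 0
  indep_latent_error : IndepFun Z E P
  indep_error : iIndepFun (fun a ω => E ω a) P
  var_error : ∀ a b, group G a = group G b →
    variance (fun ω => E ω a) P = variance (fun ω => E ω b) P

/-- The cluster separation `Δ(C) = min_{j ≠ k} (C_jj + C_kk - 2 C_jk)` of a symmetric matrix `C`
of size at least two. -/
def separation {κ : Type*} (C : Matrix κ κ ℝ) : ℝ :=
  ⨅ jk : {jk : κ × κ // jk.1 ≠ jk.2},
    (C jk.1.1 jk.1.1 + C jk.1.2 jk.1.2 - 2 * C jk.1.1 jk.1.2)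

/-- The normalized partnership matrix of a partition. -/
def partnership {p : ℕ} (G : Partition p) : Matrix (Fin p) (Fin p) ℝ :=
  Matrix.of fun a b => if group G a = group G b then ((G.part a).card : ℝ)⁻¹ else 0

/-- The data matrix, whose rows are the observations. -/
def dataMatrix {n p : ℕ} {Ω : Type*} (X : Fin n → Ω → Fin p → ℝ) (ω : Ω) :
    Matrix (Fin n) (Fin p) ℝ :=
  Matrix.of fun i a => X i ω a

/-- The sample covariance matrix `Σ̂ = 𝐗ᵗ𝐗 / n`. -/
def sampleCov {n p : ℕ} (D : Matrix (Fin n) (Fin p) ℝ) : Matrix (Fin p) (Fin p) ℝ :=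
  (n : ℝ)⁻¹ • (Dᵀ * D)

/-- The difference `𝐗_{:a} - 𝐗_{:b}` of two columns. -/
def colDiff {n p : ℕ} (D : Matrix (Fin n) (Fin p) ℝ) (a b : Fin p) : Fin n → ℝ :=
  fun i => D i a - D i b

/-- `V(a,b) = max_{c,d ∉ {a,b}} |⟨𝐗_{:a} - 𝐗_{:b}, (𝐗_{:c} - 𝐗_{:d}) / |𝐗_{:c} - 𝐗_{:d}|₂⟩|`,
with `0/0 = 0`. -/
def neighbourDist {n p : ℕ} (D : Matrix (Fin n) (Fin p) ℝ) (a b : Fin p) : ℝ :=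
  ⨆ cd : {c : Fin p // c ≠ a ∧ c ≠ b} × {d : Fin p // d ≠ a ∧ d ≠ b},
    |colDiff D a b ⬝ᵥ colDiff D cd.1 cd.2 /
      √(colDiff D cd.1 cd.2 ⬝ᵥ colDiff D cd.1 cd.2)|

/-- `ne₁(a)` minimizes `V(a,·)` over `[p] \ {a}` and `ne₂(a)` minimizes it over
`[p] \ {a, ne₁(a)}`; ties are broken arbitrarily. -/
def IsNeighbours {n p : ℕ} (D : Matrix (Fin n) (Fin p) ℝ) (ne₁ ne₂ : Fin p → Fin p) : Prop :=
  ∀ a, (ne₁ a ≠ a ∧ ∀ b, b ≠ a → neighbourDist D a (ne₁ a) ≤ neighbourDist D a b) ∧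
    (ne₂ a ≠ a ∧ ne₂ a ≠ ne₁ a ∧
      ∀ b, b ≠ a → b ≠ ne₁ a → neighbourDist D a (ne₂ a) ≤ neighbourDist D a b)

/-- The neighbour-based diagonal estimator `Γ̂`. -/
def gammaHat {n p : ℕ} (D : Matrix (Fin n) (Fin p) ℝ) (ne₁ ne₂ : Fin p → Fin p) :
    Matrix (Fin p) (Fin p) ℝ :=
  Matrix.diagonal fun a => (n : ℝ)⁻¹ * (colDiff D a (ne₁ a) ⬝ᵥ colDiff D a (ne₂ a))

/-- The feasible set `𝒞` of the semi-definite program. -/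
def feasible (p K : ℕ) : Set (Matrix (Fin p) (Fin p) ℝ) :=
  {B | B.PosSemidef ∧ (∀ b, ∑ a, B a b = 1) ∧ (∀ a b, 0 ≤ B a b) ∧ B.trace = K}

/-- `B` is an output of Steps 1 and 2 of PECOK run with `K` groups on the data matrix `D`, that is,
a maximizer of `⟨Σ̂ - Γ̂, ·⟩` over `𝒞`, with the neighbour-based `Γ̂`. -/
def IsPecokOutput {n p : ℕ} (K : ℕ) (D : Matrix (Fin n) (Fin p) ℝ)
    (B : Matrix (Fin p) (Fin p) ℝ) : Prop :=
  ∃ ne₁ ne₂ : Fin p → Fin p, IsNeighbours D ne₁ ne₂ ∧ B ∈ feasible p K ∧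
    IsMaxOn (frob (sampleCov D - gammaHat D ne₁ ne₂)) (feasible p K) B

end Pecok

end

/-! Let `A` be the partnership matrix, `B` a feasible matrix, m the smallest group size, and let
off(B) be the mass `B` puts on pairs in different groups. Signal and noise are both measured in
units of off(B), which vanishes only at `B = A`.

Signal: rows and columns of `A - B` sum to zero, so Σ̂ - Γ̂ may be altered by terms f a + f b. What
remains of the latent part is minus half a squared distance, plus a cross term with the errors; it
vanishes inside groups and is at least of order Δ across them, so it favours `A` by (Δ/8)·off(B).
Noise: what is left, W, consists of the fluctuations of the error covariance and the error of Γ̂. By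
`abs_frob_sub_le` it contributes at most (6s + t/m)·off(B), where s bounds the entries of `A * W`
and t its quadratic form. Indeed `A - B` splits into averaged parts, of ℓ¹ norm controlled by
2·off(B), and a negative semidefinite part of trace norm at most off(B)/m. If 6s + t/m < Δ/8, a
maximizer must have off(B) = 0 (`eq_partnership_of_isPecokOutput`).

Probability: covariances are scalar products of vectors x a = z a + e a in some ℝ^q, and the data
have the law of ⟪x a, ξ i⟫ with standard Gaussian ξ i (`map_eq_map_stdGaussian`). The sample
covariance is then the Gram matrix of the T (x a), where T = n^{-1/2}(⟪·, ξ i⟫)_i preserves a given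
scalar product up to a relative error of order √(x/n) + x/n, with probability at least 1 - 4e^{-x}.
A union bound over at most p⁴ pairs gives δ ≲ √(log p / n), and one over at most 25^p pairs of net
points gives ε ≲ √(p/n) + p/n. Averaging over a group gains 1/√m, so with γ = |Γ|_∞ the requirements
are δγ/√m, εγ/m and δ²γ ≲ Δ: these are the four terms of the hypothesis. The error of Γ̂ is O(δγ)
even when the neighbours lie in wrong groups. -/

namespace Pecok

/-! ### Algebra of the partnership matrix and of the feasible set. -/

variable {p : ℕ} {G : Partition p}

lemma group_eq_iff_mem_part (a b : Fin p) : group G a = group G b ↔ a ∈ G.part b := by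
  rw [G.mem_part_iff_part_eq_part (Finset.mem_univ a) (Finset.mem_univ b)]
  simp [group, Subtype.ext_iff]

lemma card_part_pos (a : Fin p) : (0 : ℝ) < (G.part a).card := by
  have : a ∈ G.part a := G.mem_part (Finset.mem_univ a)
  exact_mod_cast Finset.card_pos.2 ⟨a, this⟩

lemma minSize_le_card_part (a : Fin p) : minSize G ≤ (G.part a).card :=
  ciInf_le (OrderBot.bddBelow _) (group G a)

lemma partnership_of_eq {a b : Fin p} (h : group G a = group G b) :
    partnership G a b = ((G.part a).card : ℝ)⁻¹ := by simp [partnership, h]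

lemma partnership_of_ne {a b : Fin p} (h : group G a ≠ group G b) :
    partnership G a b = 0 := by simp [partnership, h]

lemma part_eq_of_group_eq {a b : Fin p} (h : group G a = group G b) : G.part a = G.part b := by
  simpa [group] using h

lemma partnership_nonneg (a b : Fin p) : 0 ≤ partnership G a b := by
  simp only [partnership, of_apply]
  split_ifs <;> positivity

lemma partnership_symm (a b : Fin p) : partnership G a b = partnership G b a := by
  by_cases h : group G a = group G b
  · rw [partnership_of_eq h, partnership_of_eq h.symm, part_eq_of_group_eq h]
  · rw [partnership_of_ne h, partnership_of_ne (Ne.symm h)]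

lemma partnership_transpose : (partnership G)ᵀ = partnership G := by
  ext a b
  exact partnership_symm b a

lemma sum_partnership_mul (a : Fin p) (f : Fin p → ℝ) :
    ∑ b, partnership G a b * f b = ((G.part a).card : ℝ)⁻¹ * ∑ b ∈ G.part a, f b := by
  rw [Finset.mul_sum, ← Finset.sum_filter_add_sum_filter_not _ (· ∈ G.part a),
    Finset.filter_mem_eq_inter, Finset.univ_inter]
  conv_rhs => rw [← add_zero (∑ i ∈ G.part a, _)]
  congr 1
  · refine Finset.sum_congr rfl fun b hb => ?_
    rw [partnership_of_eq ((group_eq_iff_mem_part b a).2 hb).symm]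
  · refine Finset.sum_eq_zero fun b hb => ?_
    rw [partnership_of_ne, zero_mul]
    exact fun h => (Finset.mem_filter.1 hb).2 ((group_eq_iff_mem_part b a).1 h.symm)

lemma sum_partnership (a : Fin p) : ∑ b, partnership G a b = 1 := by
  have := sum_partnership_mul (G := G) a fun _ => 1
  simp only [mul_one, Finset.sum_const, nsmul_eq_mul] at this
  rw [this, inv_mul_cancel₀ (card_part_pos a).ne']

lemma sum_partnership' (b : Fin p) : ∑ a, partnership G a b = 1 := by
  rw [← sum_partnership (G := G) b]
  exact Finset.sum_congr rfl fun a _ => partnership_symm a b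

/-- Averaging over groups twice is averaging once. Together with symmetry this makes the matrix an
orthogonal projection. -/
lemma partnership_mul_self : partnership G * partnership G = partnership G := by
  ext a b
  rw [mul_apply, sum_partnership_mul]
  have : ∀ c ∈ G.part a, partnership G c b = partnership G a b := by
    intro c hc
    have hca := (group_eq_iff_mem_part c a).2 hc
    simp [partnership, hca, part_eq_of_group_eq hca]
  rw [Finset.sum_congr rfl this, Finset.sum_const, nsmul_eq_mul,
    inv_mul_cancel_left₀ (card_part_pos a).ne']

lemma trace_partnership : (partnership G).trace = G.parts.card := by
  have h1 : ∀ a, partnership G a a = ((G.part a).card : ℝ)⁻¹ := fun a => partnership_of_eq rfl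
  simp only [trace, diag_apply, h1]
  rw [← Finset.sum_fiberwise_of_maps_to (s := Finset.univ) (t := G.parts) (g := G.part)
    fun a _ => G.part_mem.2 (Finset.mem_univ a), Finset.card_eq_sum_ones, Nat.cast_sum]
  refine Finset.sum_congr rfl fun B hB => ?_
  have hf : Finset.univ.filter (fun x => G.part x = B) = B := by
    ext x
    simp [G.part_eq_iff_mem hB]
  have : ∀ x ∈ B, ((G.part x).card : ℝ)⁻¹ = (B.card : ℝ)⁻¹ := fun x hx => by
    rw [G.part_eq_of_mem hB hx]
  rw [hf, Finset.sum_congr rfl this, Finset.sum_const, nsmul_eq_mul, Nat.cast_one]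
  refine mul_inv_cancel₀ ?_
  exact_mod_cast (Finset.card_pos.2 (G.nonempty_of_mem_parts hB)).ne'

lemma posSemidef_partnership : (partnership G).PosSemidef := by
  have := posSemidef_conjTranspose_mul_self (partnership G)
  rwa [conjTranspose_eq_transpose_of_trivial, partnership_transpose, partnership_mul_self] at this

lemma partnership_mem_feasible : partnership G ∈ feasible p G.parts.card :=
  ⟨posSemidef_partnership, sum_partnership', partnership_nonneg, trace_partnership⟩

lemma frob_eq_trace (M N : Matrix (Fin p) (Fin p) ℝ) : frob M N = (Mᵀ * N).trace := by
  simp only [frob, trace, diag_apply, mul_apply, transpose_apply]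
  exact Finset.sum_comm

/-- The total mass that `B` puts on pairs of indices in different groups. -/
noncomputable def offMass (G : Partition p) (B : Matrix (Fin p) (Fin p) ℝ) : ℝ :=
  ∑ a, ∑ b, if group G a = group G b then 0 else B a b

lemma abs_frob_le {N W : Matrix (Fin p) (Fin p) ℝ} {t : ℝ} (hN : ∀ a b, |N a b| ≤ t) :
    |frob N W| ≤ t * ∑ a, ∑ b, |W a b| := by
  rw [frob, Finset.mul_sum]
  refine (Finset.abs_sum_le_sum_abs _ _).trans (Finset.sum_le_sum fun a _ => ?_)
  rw [Finset.mul_sum]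
  refine (Finset.abs_sum_le_sum_abs _ _).trans (Finset.sum_le_sum fun b _ => ?_)
  rw [abs_mul]
  exact mul_le_mul_of_nonneg_right (hN a b) (abs_nonneg _)

-- Duality of operator norm and trace: factoring `S` as `Bᵀ * B` turns the pairing into a sum of
-- quadratic forms of `N` at the rows of `B`.
open scoped MatrixOrder in
lemma abs_frob_le_mul_trace {N S : Matrix (Fin p) (Fin p) ℝ} {t : ℝ} (hS : S.PosSemidef)
    (hN : ∀ u : Fin p → ℝ, |u ⬝ᵥ N *ᵥ u| ≤ t * (u ⬝ᵥ u)) :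
    |frob N S| ≤ t * S.trace := by
  obtain ⟨B, hB⟩ := CStarAlgebra.nonneg_iff_eq_star_mul_self.mp hS.nonneg
  rw [star_eq_conjTranspose] at hB
  have h1 : frob N S = ∑ i, B i ⬝ᵥ N *ᵥ B i := by
    rw [frob_eq_trace, hB, conjTranspose_eq_transpose_of_trivial, ← trace_transpose, transpose_mul,
      transpose_mul, transpose_transpose, transpose_transpose, mul_assoc, trace_mul_comm, mul_assoc]
    rfl
  have h2 : S.trace = ∑ i, B i ⬝ᵥ B i := by
    simp only [trace, diag_apply, hB, conjTranspose_eq_transpose_of_trivial, mul_apply,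
      transpose_apply, dotProduct]
    exact Finset.sum_comm
  rw [h1, h2, Finset.mul_sum]
  exact (Finset.abs_sum_le_sum_abs _ _).trans (Finset.sum_le_sum fun i _ => hN _)

lemma feasible_symm {K : ℕ} {B : Matrix (Fin p) (Fin p) ℝ} (hB : B ∈ feasible p K) (a b : Fin p) :
    B a b = B b a := by
  have := hB.1.isHermitian.apply b a
  simpa using this

lemma feasible_transpose {K : ℕ} {B : Matrix (Fin p) (Fin p) ℝ} (hB : B ∈ feasible p K) :
    Bᵀ = B := by
  ext a b
  exact feasible_symm hB b a

lemma sum_feasible {K : ℕ} {B : Matrix (Fin p) (Fin p) ℝ} (hB : B ∈ feasible p K) (a : Fin p) :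
    ∑ b, B a b = 1 := by
  rw [← hB.2.1 a]
  exact Finset.sum_congr rfl fun b _ => feasible_symm hB a b

lemma offMass_nonneg {K : ℕ} {B : Matrix (Fin p) (Fin p) ℝ} (hB : B ∈ feasible p K) :
    0 ≤ offMass G B := by
  refine Finset.sum_nonneg fun a _ => Finset.sum_nonneg fun b _ => ?_
  split_ifs
  exacts [le_rfl, hB.2.2.1 a b]

/-- The averaged defect `A (A - B)` is nonnegative inside the groups. -/
lemma partnership_mul_sub_of_eq {K : ℕ} {B : Matrix (Fin p) (Fin p) ℝ} (hB : B ∈ feasible p K)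
    {a b : Fin p} (h : group G a = group G b) :
    (partnership G * (partnership G - B)) a b
      = ((G.part a).card : ℝ)⁻¹ * ∑ c, if group G c = group G b then 0 else B c b := by
  rw [mul_sub, partnership_mul_self, Matrix.sub_apply, partnership_of_eq h, mul_apply,
    sum_partnership_mul, ← mul_one_sub, ← hB.2.1 b]
  congr 1
  rw [sub_eq_iff_eq_add, ← Finset.sum_filter_add_sum_filter_not _ (· ∈ G.part a),
    Finset.filter_mem_eq_inter, Finset.univ_inter, add_comm, Finset.sum_filter]
  congr 1
  refine Finset.sum_congr rfl fun c _ => ?_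
  simp only [← group_eq_iff_mem_part, h, ite_not]

lemma partnership_mul_sub_of_ne {K : ℕ} {B : Matrix (Fin p) (Fin p) ℝ} (hB : B ∈ feasible p K)
    {a b : Fin p} (h : group G a ≠ group G b) :
    (partnership G * (partnership G - B)) a b ≤ 0 := by
  rw [mul_sub, partnership_mul_self, Matrix.sub_apply, partnership_of_ne h, mul_apply, zero_sub,
    Left.neg_nonpos_iff]
  exact Finset.sum_nonneg fun c _ => mul_nonneg (partnership_nonneg _ _) (hB.2.2.1 _ _)

lemma sum_partnership_mul_sub {K : ℕ} {B : Matrix (Fin p) (Fin p) ℝ} (hB : B ∈ feasible p K)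
    (b : Fin p) : ∑ a, (partnership G * (partnership G - B)) a b = 0 := by
  simp only [mul_apply]
  rw [Finset.sum_comm]
  simp_rw [← Finset.sum_mul, sum_partnership', one_mul, Matrix.sub_apply, Finset.sum_sub_distrib,
    sum_partnership', hB.2.1, sub_self]

/-- Each column of `A (A - B)` is nonnegative inside the group, nonpositive outside, and sums to
zero. Its ℓ¹ norm is thus twice its in-group sum, which is the off-group mass of that column of `B`.
-/
lemma sum_abs_partnership_mul_sub {K : ℕ} {B : Matrix (Fin p) (Fin p) ℝ}
    (hB : B ∈ feasible p K) :
    ∑ a, ∑ b, |(partnership G * (partnership G - B)) a b| = 2 * offMass G B := by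
  have hoff : offMass G B = ∑ b, ∑ a, if group G a = group G b then 0 else B a b :=
    Finset.sum_comm
  rw [hoff, Finset.sum_comm, Finset.mul_sum]
  refine Finset.sum_congr rfl fun b _ => ?_
  set W := partnership G * (partnership G - B) with hW
  have h1 : ∀ a, |W a b| = 2 * (if group G a = group G b then W a b else 0) - W a b := by
    intro a
    split_ifs with h
    · rw [abs_of_nonneg]
      · ring
      rw [hW, partnership_mul_sub_of_eq hB h]
      refine mul_nonneg (by positivity) (Finset.sum_nonneg fun c _ => ?_)
      split_ifs
      exacts [le_rfl, hB.2.2.1 c b]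
    · rw [abs_of_nonpos (partnership_mul_sub_of_ne hB h)]
      ring
  have h2 : ∀ a, (if group G a = group G b then W a b else 0) = partnership G a b *
      ∑ c, if group G c = group G b then 0 else B c b := by
    intro a
    split_ifs with h
    · rw [hW, partnership_mul_sub_of_eq hB h, partnership_of_eq h]
    · rw [partnership_of_ne h, zero_mul]
  simp_rw [h1, Finset.sum_sub_distrib, ← Finset.mul_sum, h2, ← Finset.sum_mul, sum_partnership',
    one_mul]
  rw [hW, sum_partnership_mul_sub hB, sub_zero]

/-- The constraint tr B = K = tr A turns this trace into that of `A (A - B)`, whose diagonal entries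
are off-group column masses divided by group sizes. -/
lemma trace_compression_le {B : Matrix (Fin p) (Fin p) ℝ} (hB : B ∈ feasible p G.parts.card)
    (hm : 0 < minSize G) :
    ((1 - partnership G) * B * (1 - partnership G)).trace ≤ offMass G B / minSize G := by
  have h1 : ((1 - partnership G) * B * (1 - partnership G)).trace
      = ((partnership G) * (partnership G - B)).trace := by
    rw [trace_mul_comm, ← mul_assoc, trace_mul_comm]
    have : (1 - partnership G) * (1 - partnership G) = 1 - partnership G := by
      rw [sub_mul, mul_sub, mul_sub, partnership_mul_self]
      simp
    rw [this, mul_sub, mul_sub, mul_one, trace_sub, trace_sub, hB.2.2.2, partnership_mul_self,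
      trace_partnership, trace_mul_comm]
  rw [h1, trace, offMass, Finset.sum_comm, Finset.sum_div]
  refine Finset.sum_le_sum fun b _ => ?_
  rw [diag_apply, partnership_mul_sub_of_eq hB rfl, div_eq_inv_mul]
  refine mul_le_mul_of_nonneg_right ?_ (Finset.sum_nonneg fun c _ => ?_)
  · gcongr
    exact minSize_le_card_part b
  · split_ifs
    exacts [le_rfl, hB.2.2.1 c b]

lemma posSemidef_compression {B : Matrix (Fin p) (Fin p) ℝ} (hB : B.PosSemidef) :
    ((1 - partnership G) * B * (1 - partnership G)).PosSemidef := by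
  have := hB.mul_mul_conjTranspose_same (1 - partnership G)
  rwa [conjTranspose_eq_transpose_of_trivial, transpose_sub, transpose_one,
    partnership_transpose] at this

/-- Block decomposition along the range and kernel of the projection `A`; the kernel block of `A`
itself is zero. -/
lemma sub_eq_averages_sub_compression (B : Matrix (Fin p) (Fin p) ℝ) :
    partnership G - B = partnership G * (partnership G - B) + (partnership G - B) * partnership G
      - partnership G * (partnership G - B) * partnership G
      - (1 - partnership G) * B * (1 - partnership G) := by
  have h := partnership_mul_self (G := G)
  simp only [mul_sub, sub_mul, one_mul, mul_one, h]
  abel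

/-- The averaged blocks vanish by the ℓ¹ identity, and the compression is positive semidefinite of
trace zero. -/
lemma eq_partnership_of_offMass_eq_zero {B : Matrix (Fin p) (Fin p) ℝ}
    (hB : B ∈ feasible p G.parts.card) (hm : 0 < minSize G) (h0 : offMass G B = 0) :
    B = partnership G := by
  have h1 : partnership G * (partnership G - B) = 0 := by
    have h := sum_abs_partnership_mul_sub (G := G) hB
    rw [h0, mul_zero, Finset.sum_eq_zero_iff_of_nonneg
      fun a _ => Finset.sum_nonneg fun b _ => abs_nonneg _] at h
    ext a b
    have h' := h a (Finset.mem_univ a)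
    rw [Finset.sum_eq_zero_iff_of_nonneg fun b _ => abs_nonneg _] at h'
    exact abs_eq_zero.1 (h' b (Finset.mem_univ b))
  have h2 : (partnership G - B) * partnership G = 0 := by
    have := congrArg transpose h1
    rwa [transpose_mul, transpose_sub, partnership_transpose, feasible_transpose hB,
      transpose_zero] at this
  have h3 : (1 - partnership G) * B * (1 - partnership G) = 0 := by
    refine (posSemidef_compression hB.1).trace_eq_zero_iff.1 (le_antisymm ?_ ?_)
    · simpa [h0] using trace_compression_le hB hm
    · exact (posSemidef_compression hB.1).trace_nonneg
  have h4 := sub_eq_averages_sub_compression (G := G) B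
  rw [h1, h2, h3] at h4
  simp only [zero_mul, add_zero, sub_zero] at h4
  exact (sub_eq_zero.1 h4).symm

/-- Noise bound: a symmetric matrix pairs with `A - B` at most as its group averages and its
operator norm allow. -/
lemma abs_frob_sub_le {B N : Matrix (Fin p) (Fin p) ℝ} (hB : B ∈ feasible p G.parts.card)
    (hm : 0 < minSize G) (hN : Nᵀ = N) {s t : ℝ} (hs : ∀ a b, |(partnership G * N) a b| ≤ s)
    (ht : 0 ≤ t) (hop : ∀ u : Fin p → ℝ, |u ⬝ᵥ N *ᵥ u| ≤ t * (u ⬝ᵥ u)) :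
    |frob N (partnership G - B)| ≤ (6 * s + t / minSize G) * offMass G B := by
  set A := partnership G with hA
  set M := A - B with hM
  have hAt : Aᵀ = A := partnership_transpose
  have hAA : A * A = A := partnership_mul_self
  have hMt : Mᵀ = M := by rw [hM, transpose_sub, hAt, feasible_transpose hB]
  have hsum : ∑ a, ∑ b, |(A * M) a b| = 2 * offMass G B := sum_abs_partnership_mul_sub hB
  -- Since `A` is a symmetric idempotent it can be moved across the pairing, so outside the
  -- compression only the averages of `N` matter.
  have hsplit : frob N M = frob (A * N) (A * M) + frob (A * N) (A * M)
      - frob (A * N * A) (A * M) - frob N ((1 - A) * B * (1 - A)) := by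
    have h1 : (Nᵀ * (M * A)).trace = ((A * N)ᵀ * (A * M)).trace := by
      rw [← trace_transpose, transpose_mul, transpose_mul, transpose_transpose, hAt, hMt,
        trace_mul_comm, transpose_mul, hAt, hN, mul_assoc N A, ← mul_assoc A A, hAA]
    have h2 : (Nᵀ * (A * M)).trace = ((A * N)ᵀ * (A * M)).trace := by
      rw [transpose_mul, hAt, mul_assoc Nᵀ A, ← mul_assoc A A, hAA]
    have h3 : (Nᵀ * (A * M * A)).trace = ((A * N * A)ᵀ * (A * M)).trace := by
      rw [transpose_mul, transpose_mul, hAt, hN, ← mul_assoc N, trace_mul_comm, ← mul_assoc A N A,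
        mul_assoc (A * N) A, ← mul_assoc A A, hAA, mul_assoc]
    simp only [frob_eq_trace]
    rw [← h2]
    nth_rewrite 2 [h2]
    rw [← h1, ← h3, ← trace_add, ← trace_sub, ← trace_sub, ← mul_add, ← mul_sub, ← mul_sub,
      ← sub_eq_averages_sub_compression]
  have hs2 : ∀ a b, |(A * N * A) a b| ≤ s := by
    intro a b
    rw [mul_apply]
    calc |∑ c, (A * N) a c * A c b| ≤ ∑ c, |(A * N) a c * A c b| := Finset.abs_sum_le_sum_abs _ _
      _ ≤ ∑ c, s * A c b := by
          refine Finset.sum_le_sum fun c _ => ?_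
          rw [abs_mul, abs_of_nonneg (partnership_nonneg c b)]
          exact mul_le_mul_of_nonneg_right (hs a c) (partnership_nonneg c b)
      _ = s := by rw [← Finset.mul_sum, sum_partnership', mul_one]
  have b1 := abs_frob_le (W := A * M) hs
  have b2 := abs_frob_le (W := A * M) hs2
  have b3 := abs_frob_le_mul_trace (posSemidef_compression (G := G) hB.1) hop
  have b4 := mul_le_mul_of_nonneg_left (trace_compression_le hB hm) ht
  rw [hsum] at b1 b2
  rw [← hA] at b3 b4
  have b5 : t * (offMass G B / minSize G) = t / minSize G * offMass G B := by ring
  rw [hsplit]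
  rw [abs_le] at *
  constructor <;> linarith [b1.1, b1.2, b2.1, b2.2, b3.1, b3.2]

end Pecok

/-! ### Near isometries and the neighbour-based estimator. -/

namespace Pecok

open scoped RealInnerProductSpace

section Deterministic

variable {n p : ℕ} {G : Partition p} {H F : Type*} [NormedAddCommGroup H] [InnerProductSpace ℝ H]
  [NormedAddCommGroup F] [InnerProductSpace ℝ F]

/-- `T` preserves the scalar product of `u` and `v` up to the relative error `δ`. -/
def NearIsometry (T : H →ₗ[ℝ] F) (δ : ℝ) (u v : H) : Prop :=
  |⟪T u, T v⟫ - ⟪u, v⟫| ≤ δ * (‖u‖ * ‖v‖)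

lemma NearIsometry.abs_inner_le {T : H →ₗ[ℝ] F} {δ : ℝ} {u v : H} (h : NearIsometry T δ u v)
    (h0 : ⟪u, v⟫ = 0) : |⟪T u, T v⟫| ≤ δ * (‖u‖ * ‖v‖) := by
  simpa [NearIsometry, h0] using h

lemma NearIsometry.norm_sq_le {T : H →ₗ[ℝ] F} {δ : ℝ} {u : H} (h : NearIsometry T δ u u) :
    ‖T u‖ ^ 2 ≤ (1 + δ) * ‖u‖ ^ 2 := by
  have := (abs_le.1 h).2
  rw [real_inner_self_eq_norm_sq, real_inner_self_eq_norm_sq] at this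
  linarith

lemma NearIsometry.le_norm_sq {T : H →ₗ[ℝ] F} {δ : ℝ} {u : H} (h : NearIsometry T δ u u) :
    (1 - δ) * ‖u‖ ^ 2 ≤ ‖T u‖ ^ 2 := by
  have := (abs_le.1 h).1
  rw [real_inner_self_eq_norm_sq, real_inner_self_eq_norm_sq] at this
  linarith

/-- Vectors with the scalar products of a latent decomposition: `z a` depends on the group of `a`
only, and the `e a` are orthogonal to each other and to all `z b`. -/
structure LatentVectors (G : Partition p) (z e : Fin p → H) (γ : ℝ) : Prop where
  eq_of_group_eq : ∀ a b, group G a = group G b → z a = z b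
  inner_latent_error : ∀ a b, ⟪z a, e b⟫ = 0
  inner_error : ∀ a b, a ≠ b → ⟪e a, e b⟫ = 0
  norm_sq_error_le : ∀ a, ‖e a‖ ^ 2 ≤ γ

variable {z e : Fin p → H} {γ δ : ℝ} {T : H →ₗ[ℝ] F}

lemma LatentVectors.inner_sub_sub (h : LatentVectors G z e γ) {a b c d : Fin p} (hac : a ≠ c)
    (had : a ≠ d) (hbc : b ≠ c) (hbd : b ≠ d) :
    ⟪(z a + e a) - (z b + e b), (z c + e c) - (z d + e d)⟫ = ⟪z a - z b, z c - z d⟫ := by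
  have h1 : ∀ x y, ⟪e x, z y⟫ = 0 := fun x y => by rw [real_inner_comm, h.inner_latent_error]
  simp only [inner_sub_left, inner_sub_right, inner_add_left, inner_add_right,
    h.inner_latent_error, h1, h.inner_error a c hac, h.inner_error a d had,
    h.inner_error b c hbc, h.inner_error b d hbd]
  ring

lemma LatentVectors.inner_sub_sub_left (h : LatentVectors G z e γ) {a b c : Fin p} (hab : a ≠ b)
    (hac : a ≠ c) (hbc : b ≠ c) :
    ⟪(z a + e a) - (z b + e b), (z a + e a) - (z c + e c)⟫ = ⟪z a - z b, z a - z c⟫ + ‖e a‖ ^ 2 := by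
  have h1 : ∀ x y, ⟪e x, z y⟫ = 0 := fun x y => by rw [real_inner_comm, h.inner_latent_error]
  simp only [inner_sub_left, inner_sub_right, inner_add_left, inner_add_right,
    h.inner_latent_error, h1, h.inner_error a c hac, h.inner_error b a hab.symm,
    h.inner_error b c hbc, real_inner_self_eq_norm_sq]
  ring

lemma LatentVectors.norm_sq_sub (h : LatentVectors G z e γ) {a b : Fin p} (hab : a ≠ b) :
    ‖(z a + e a) - (z b + e b)‖ ^ 2 = ‖z a - z b‖ ^ 2 + ‖e a‖ ^ 2 + ‖e b‖ ^ 2 := by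
  have h1 : ∀ x y, ⟪e x, z y⟫ = 0 := fun x y => by rw [real_inner_comm, h.inner_latent_error]
  simp only [← real_inner_self_eq_norm_sq, inner_sub_left, inner_sub_right, inner_add_left,
    inner_add_right, h.inner_latent_error, h1, h.inner_error a b hab, h.inner_error b a hab.symm]
  ring

lemma LatentVectors.norm_sq_sub_le (h : LatentVectors G z e γ) {a b : Fin p} (hab : a ≠ b) :
    ‖(z a + e a) - (z b + e b)‖ ^ 2 ≤ ‖z a - z b‖ ^ 2 + 2 * γ := by
  linarith [h.norm_sq_sub hab, h.norm_sq_error_le a, h.norm_sq_error_le b]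

lemma LatentVectors.nonneg (h : LatentVectors G z e γ) (a : Fin p) : 0 ≤ γ :=
  (sq_nonneg _).trans (h.norm_sq_error_le a)

lemma inv_mul_colDiff_dotProduct {D : Matrix (Fin n) (Fin p) ℝ} {x : Fin p → H}
    (hD : ∀ a b, sampleCov D a b = ⟪T (x a), T (x b)⟫) (a b c d : Fin p) :
    (n : ℝ)⁻¹ * (colDiff D a b ⬝ᵥ colDiff D c d) = ⟪T (x a - x b), T (x c - x d)⟫ := by
  simp only [map_sub, inner_sub_left, inner_sub_right, ← hD]
  simp only [sampleCov, Matrix.smul_apply, mul_apply, transpose_apply, smul_eq_mul, dotProduct, colDiff]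
  simp only [← mul_sub, ← Finset.sum_sub_distrib]
  congr 1
  exact Finset.sum_congr rfl fun i _ => by ring

/-- The factor `√n` comes from the normalization of `sampleCov`. If `T (x c - x d) = 0`, the
convention 0/0 = 0 agrees with the trivial inequality on the right. -/
lemma neighbourDist_le_iff (hn : 0 < n) {D : Matrix (Fin n) (Fin p) ℝ} {x : Fin p → H}
    (hD : ∀ a b, sampleCov D a b = ⟪T (x a), T (x b)⟫) {a b : Fin p} {t : ℝ} (ht : 0 ≤ t) :
    neighbourDist D a b ≤ √n * t ↔ ∀ c d, c ≠ a → c ≠ b → d ≠ a → d ≠ b →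
      |⟪T (x a - x b), T (x c - x d)⟫| ≤ t * ‖T (x c - x d)‖ := by
  have hn' : (0 : ℝ) < n := by exact_mod_cast hn
  have hdot : ∀ a b c d, colDiff D a b ⬝ᵥ colDiff D c d = n * ⟪T (x a - x b), T (x c - x d)⟫ := by
    intro a b c d
    rw [← inv_mul_colDiff_dotProduct hD, mul_inv_cancel_left₀ hn'.ne']
  have hterm : ∀ c d, |colDiff D a b ⬝ᵥ colDiff D c d / √(colDiff D c d ⬝ᵥ colDiff D c d)| ≤ √n * t
      ↔ |⟪T (x a - x b), T (x c - x d)⟫| ≤ t * ‖T (x c - x d)‖ := by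
    intro c d
    rw [hdot, hdot, real_inner_self_eq_norm_sq, Real.sqrt_mul hn'.le, Real.sqrt_sq (norm_nonneg _)]
    rcases eq_or_lt_of_le (norm_nonneg (T (x c - x d))) with h0 | h0
    · have : T (x c - x d) = 0 := norm_eq_zero.1 h0.symm
      rw [this]
      simp only [inner_zero_right, mul_zero, zero_div, norm_zero, abs_zero, le_refl, iff_true]
      positivity
    · have hs : 0 < √(n : ℝ) := Real.sqrt_pos.2 hn'
      rw [abs_div, abs_mul, abs_of_pos hn', abs_of_pos (mul_pos hs h0), div_le_iff₀ (mul_pos hs h0)]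
      nth_rewrite 1 [← Real.mul_self_sqrt hn'.le]
      rw [show √(n : ℝ) * t * (√n * ‖T (x c - x d)‖) = √n * √n * (t * ‖T (x c - x d)‖) by ring]
      exact mul_le_mul_iff_right₀ (mul_pos hs hs)
  constructor
  · intro h c d hca hcb hda hdb
    rw [← hterm]
    exact (le_ciSup (Set.finite_range _).bddAbove
      ((⟨c, hca, hcb⟩, ⟨d, hda, hdb⟩) :
        {c : Fin p // c ≠ a ∧ c ≠ b} × {d : Fin p // d ≠ a ∧ d ≠ b})).trans h
  · intro h
    refine Real.iSup_le (fun cd => ?_) (by positivity)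
    rw [hterm]
    exact h _ _ cd.1.2.1 cd.1.2.2 cd.2.2.1 cd.2.2.2

/-- Groups of three leave room for two in-group candidate neighbours, and for a test index in the
group of `a` that avoids both `a` and `b`. -/
lemma exists_mem_part_ne (hm : 3 ≤ minSize G) (a b : Fin p) :
    ∃ c, group G c = group G a ∧ c ≠ a ∧ c ≠ b := by
  have h1 := hm.trans (minSize_le_card_part a)
  have h2 : (({a, b} : Finset (Fin p))).card ≤ 2 := Finset.card_le_two
  obtain ⟨c, hc, hcab⟩ := Finset.exists_mem_notMem_of_card_lt_card
    (by omega : (({a, b} : Finset (Fin p))).card < (G.part a).card)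
  refine ⟨c, (group_eq_iff_mem_part c a).2 hc, ?_, ?_⟩ <;> rintro rfl <;> simp at hcab

/-- Inside a group the latent parts cancel: the difference is orthogonal to every test direction and
has squared norm at most 2γ. Normalizing by the sample norm costs 1/√(1 - δ), absorbed in the factor
2. -/
lemma neighbourDist_le_of_group_eq (hn : 0 < n) {D : Matrix (Fin n) (Fin p) ℝ}
    (hD : ∀ a b, sampleCov D a b = ⟪T (z a + e a), T (z b + e b)⟫) (h : LatentVectors G z e γ)
    (hδ : 0 ≤ δ) (hδ' : δ ≤ 1 / 10)
    (hT : ∀ a b c d, NearIsometry T δ ((z a + e a) - (z b + e b)) ((z c + e c) - (z d + e d)))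
    {a b : Fin p} (hab : a ≠ b) (hg : group G a = group G b) :
    neighbourDist D a b ≤ √n * (2 * δ * √γ) := by
  have hγ := h.nonneg a
  rw [neighbourDist_le_iff hn hD (by positivity)]
  intro c d hca hcb hda hdb
  have hz : z a - z b = 0 := sub_eq_zero.2 (h.eq_of_group_eq a b hg)
  have h1 := (hT a b c d).abs_inner_le (by
    rw [h.inner_sub_sub hca.symm hda.symm hcb.symm hdb.symm, hz, inner_zero_left])
  refine h1.trans ?_
  rw [mul_comm 2 δ, mul_assoc, mul_assoc]
  refine mul_le_mul_of_nonneg_left ?_ hδ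
  have h2 : ‖(z a + e a) - (z b + e b)‖ ^ 2 ≤ 2 * γ := by
    simpa [hz] using h.norm_sq_sub_le hab
  have h3 := (hT c d c d).le_norm_sq
  refine (abs_le_of_sq_le_sq' ?_ ?_).2
  swap
  · positivity
  rw [mul_pow, mul_pow, mul_pow, Real.sq_sqrt hγ]
  nlinarith [sq_nonneg ‖(z c + e c) - (z d + e d)‖,
    mul_le_mul_of_nonneg_right h2 (sq_nonneg ‖(z c + e c) - (z d + e d)‖),
    mul_nonneg hγ (sq_nonneg ‖(z c + e c) - (z d + e d)‖)]

/-- Testing on `c` in the group of `a` and `d` in that of `b` reveals r = ‖z a - z b‖² as a scalar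
product, whence r ≤ 3δ(r + 2γ), to be solved for r. No separation is needed. -/
lemma norm_sq_latent_sub_le (hn : 0 < n) {D : Matrix (Fin n) (Fin p) ℝ}
    (hD : ∀ a b, sampleCov D a b = ⟪T (z a + e a), T (z b + e b)⟫) (h : LatentVectors G z e γ)
    (hm : 3 ≤ minSize G) (hδ : 0 ≤ δ) (hδ' : δ ≤ 1 / 10)
    (hT : ∀ a b c d, NearIsometry T δ ((z a + e a) - (z b + e b)) ((z c + e c) - (z d + e d)))
    {a b : Fin p} (hab : a ≠ b) (hV : neighbourDist D a b ≤ √n * (2 * δ * √γ)) :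
    ‖z a - z b‖ ^ 2 ≤ 10 * (δ * γ) := by
  have hγ := h.nonneg a
  by_cases hg : group G a = group G b
  · rw [h.eq_of_group_eq a b hg, sub_self, norm_zero, zero_pow two_ne_zero]
    positivity
  obtain ⟨c, hc, hca, hcb⟩ := exists_mem_part_ne hm a b
  obtain ⟨d, hd, hdb, hda⟩ := exists_mem_part_ne hm b a
  have hcd : c ≠ d := by
    rintro rfl
    exact hg (hc.symm.trans hd)
  rw [neighbourDist_le_iff hn hD (by positivity)] at hV
  have h1 := hV c d hca hcb hda hdb
  have h2 := hT a b c d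
  rw [NearIsometry, h.inner_sub_sub hca.symm hda.symm hcb.symm hdb.symm, h.eq_of_group_eq c a hc,
    h.eq_of_group_eq d b hd, real_inner_self_eq_norm_sq] at h2
  have h3 := (hT c d c d).norm_sq_le
  have h4 := h.norm_sq_sub_le hab
  have h5 := h.norm_sq_sub_le hcd
  rw [h.eq_of_group_eq c a hc, h.eq_of_group_eq d b hd] at h1 h3 h5
  set s := ‖z a - z b‖ ^ 2 + 2 * γ with hs
  have hs0 : 0 ≤ s := by positivity
  have h6 : ‖(z a + e a) - (z b + e b)‖ * ‖(z a + e c) - (z b + e d)‖ ≤ s := by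
    nlinarith [sq_nonneg (‖(z a + e a) - (z b + e b)‖ - ‖(z a + e c) - (z b + e d)‖)]
  have h7 : √γ * ‖T ((z a + e c) - (z b + e d))‖ ≤ s := by
    refine (abs_le_of_sq_le_sq' ?_ hs0).2
    rw [mul_pow, Real.sq_sqrt hγ]
    have h8 : ‖T ((z a + e c) - (z b + e d))‖ ^ 2 ≤ 2 * s := by nlinarith
    have h9 : 2 * γ ≤ s := by rw [hs]; linarith [sq_nonneg ‖z a - z b‖]
    nlinarith
  have h8 : ‖z a - z b‖ ^ 2 ≤ 3 * (δ * s) := by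
    have e1 := (abs_le.1 h2).1
    have e2 := (abs_le.1 h1).2
    nlinarith [mul_le_mul_of_nonneg_left h6 hδ, mul_le_mul_of_nonneg_left h7 hδ]
  nlinarith [mul_nonneg hδ hγ, mul_nonneg (sub_nonneg.2 hδ') (sq_nonneg ‖z a - z b‖)]

/-- The neighbour-based estimator is accurate even when the neighbours are in a wrong group. -/
lemma abs_gammaHat_sub_le (hn : 0 < n) {D : Matrix (Fin n) (Fin p) ℝ}
    (hD : ∀ a b, sampleCov D a b = ⟪T (z a + e a), T (z b + e b)⟫) (h : LatentVectors G z e γ)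
    (hm : 3 ≤ minSize G) (hδ : 0 ≤ δ) (hδ' : δ ≤ 1 / 10)
    (hT : ∀ a b c d, NearIsometry T δ ((z a + e a) - (z b + e b)) ((z c + e c) - (z d + e d)))
    {ne₁ ne₂ : Fin p → Fin p} (hne : IsNeighbours D ne₁ ne₂) (a : Fin p) :
    |gammaHat D ne₁ ne₂ a a - ‖e a‖ ^ 2| ≤ 13 * (δ * γ) := by
  have hγ := h.nonneg a
  obtain ⟨⟨h1a, h1⟩, h2a, h21, h2⟩ := hne a
  have hin : ∀ b, group G b = group G a → b ≠ a → neighbourDist D a b ≤ √n * (2 * δ * √γ) :=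
    fun b hb hba => neighbourDist_le_of_group_eq hn hD h hδ hδ' hT hba.symm hb.symm
  have hV1 : neighbourDist D a (ne₁ a) ≤ √n * (2 * δ * √γ) := by
    obtain ⟨b, hb, hba, -⟩ := exists_mem_part_ne hm a a
    exact (h1 b hba).trans (hin b hb hba)
  have hV2 : neighbourDist D a (ne₂ a) ≤ √n * (2 * δ * √γ) := by
    obtain ⟨b, hb, hba, hb1⟩ := exists_mem_part_ne hm a (ne₁ a)
    exact (h2 b hba hb1).trans (hin b hb hba)
  have hz1 := norm_sq_latent_sub_le hn hD h hm hδ hδ' hT h1a.symm hV1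
  have hz2 := norm_sq_latent_sub_le hn hD h hm hδ hδ' hT h2a.symm hV2
  have hx1 := h.norm_sq_sub_le h1a.symm
  have hx2 := h.norm_sq_sub_le h2a.symm
  have hiso := hT a (ne₁ a) a (ne₂ a)
  rw [NearIsometry, h.inner_sub_sub_left h1a.symm h2a.symm h21.symm] at hiso
  rw [gammaHat, diagonal_apply_eq, inv_mul_colDiff_dotProduct (x := fun a => z a + e a) hD]
  have hzz := abs_real_inner_le_norm (z a - z (ne₁ a)) (z a - z (ne₂ a))
  have hzz' : ‖z a - z (ne₁ a)‖ * ‖z a - z (ne₂ a)‖ ≤ 10 * (δ * γ) := by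
    nlinarith [sq_nonneg (‖z a - z (ne₁ a)‖ - ‖z a - z (ne₂ a)‖)]
  have hxx : ‖(z a + e a) - (z (ne₁ a) + e (ne₁ a))‖ * ‖(z a + e a) - (z (ne₂ a) + e (ne₂ a))‖
      ≤ 3 * γ := by
    nlinarith [sq_nonneg (‖(z a + e a) - (z (ne₁ a) + e (ne₁ a))‖ -
      ‖(z a + e a) - (z (ne₂ a) + e (ne₂ a))‖), mul_nonneg (sub_nonneg.2 hδ') hγ]
  have hxx' := mul_le_mul_of_nonneg_left hxx hδ
  have a1 := abs_le.1 hiso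
  have a2 := abs_le.1 (hzz.trans hzz')
  -- The constant 13 is 10 from the latent differences plus 3 from the near isometry.
  rw [abs_le]
  constructor <;> linarith [a1.1, a1.2, a2.1, a2.2]

end Deterministic

end Pecok

/-! ### Nets and quadratic forms. -/

namespace Pecok

open scoped RealInnerProductSpace

section Net

variable {E F : Type*} [NormedAddCommGroup E] [NormedSpace ℝ E] [NormedAddCommGroup F]
  [NormedSpace ℝ F]

/-- The unit ball has a `1/2`-net of cardinality at most `5 ^ dim`. -/
lemma exists_half_net (E : Type*) [NormedAddCommGroup E] [NormedSpace ℝ E]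
    [FiniteDimensional ℝ E] :
    ∃ N : Finset E, N.card ≤ 5 ^ Module.finrank ℝ E ∧ (∀ v ∈ N, ‖v‖ ≤ 1) ∧
      ∀ u : E, ‖u‖ ≤ 1 → ∃ v ∈ N, ‖u - v‖ ≤ 1 / 2 := by
  classical
  set d := Module.finrank ℝ E
  -- A 1-separated subset of the ball of radius 2 with the most points is a 1-net of that ball, and
  -- is halved at the end. These scales are those of `Besicovitch.card_le_of_separated`.
  let good : Finset E → Prop := fun s => (∀ c ∈ s, ‖c‖ ≤ 2) ∧
    ∀ c ∈ s, ∀ d ∈ s, c ≠ d → 1 ≤ ‖c - d‖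
  have hcard : ∀ s, good s → s.card ≤ 5 ^ d := fun s hs =>
    Besicovitch.card_le_of_separated s hs.1 hs.2
  have hne : ∃ k, ∃ s, good s ∧ s.card = k := ⟨0, ∅, by simp [good], rfl⟩
  have hbdd : ∀ k, (∃ s, good s ∧ s.card = k) → k ≤ 5 ^ d := by
    rintro k ⟨s, hs, rfl⟩
    exact hcard s hs
  obtain ⟨s, hs, hsk⟩ := Nat.findGreatest_spec (P := fun k => ∃ s, good s ∧ s.card = k)
    (hbdd _ hne.choose_spec) hne.choose_spec
  have hmax : ∀ t, good t → t.card ≤ s.card := fun t ht => by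
    rw [hsk]
    exact Nat.le_findGreatest (hcard t ht) ⟨t, ht, rfl⟩
  refine ⟨s.image fun v => (1 / 2 : ℝ) • v, Finset.card_image_le.trans (hcard s hs), ?_, ?_⟩
  · intro v hv
    obtain ⟨w, hw, rfl⟩ := Finset.mem_image.1 hv
    rw [norm_smul, Real.norm_of_nonneg (by norm_num)]
    linarith [hs.1 w hw]
  · intro u hu
    have h2u : ‖(2 : ℝ) • u‖ ≤ 2 := by
      rw [norm_smul, Real.norm_of_nonneg (by norm_num)]
      linarith
    obtain ⟨w, hw, hwu⟩ : ∃ w ∈ s, ‖(2 : ℝ) • u - w‖ ≤ 1 := by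
      by_contra! hcon
      have hnot : (2 : ℝ) • u ∉ s := fun hmem => by
        have := hcon _ hmem
        rw [sub_self, norm_zero] at this
        linarith
      have hgood : good (insert ((2 : ℝ) • u) s) := by
        refine ⟨fun c hc => ?_, fun c hc d hd hcd => ?_⟩
        · rcases Finset.mem_insert.1 hc with rfl | hc
          exacts [h2u, hs.1 c hc]
        · rcases Finset.mem_insert.1 hc with rfl | hc
          · rcases Finset.mem_insert.1 hd with rfl | hd
            · exact absurd rfl hcd
            · exact (hcon d hd).le
          · rcases Finset.mem_insert.1 hd with rfl | hd
            · rw [norm_sub_rev]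
              exact (hcon c hc).le
            · exact hs.2 c hc d hd hcd
      have := hmax _ hgood
      rw [Finset.card_insert_of_notMem hnot] at this
      omega
    refine ⟨(1 / 2 : ℝ) • w, Finset.mem_image_of_mem _ hw, ?_⟩
    rw [show u - (1 / 2 : ℝ) • w = (1 / 2 : ℝ) • ((2 : ℝ) • u - w) by module, norm_smul,
      Real.norm_of_nonneg (by norm_num)]
    linarith

lemma norm_le_of_half_net {N : Finset E}
    (hN : ∀ u : E, ‖u‖ ≤ 1 → ∃ v ∈ N, ‖u - v‖ ≤ 1 / 2) (L : E →L[ℝ] F) {ε : ℝ} (hε : 0 ≤ ε)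
    (hL : ∀ v ∈ N, ‖L v‖ ≤ ε) : ‖L‖ ≤ 2 * ε := by
  have : ‖L‖ ≤ ε + ‖L‖ * (1 / 2) := by
    refine L.opNorm_le_of_unit_norm (by positivity) fun u hu => ?_
    obtain ⟨v, hv, huv⟩ := hN u hu.le
    calc ‖L u‖ = ‖L v + L (u - v)‖ := by rw [← map_add, add_sub_cancel]
      _ ≤ ‖L v‖ + ‖L (u - v)‖ := norm_add_le _ _
      _ ≤ ε + ‖L‖ * (1 / 2) := add_le_add (hL v hv)
          ((L.le_opNorm _).trans (mul_le_mul_of_nonneg_left huv (norm_nonneg _)))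
  linarith

/-- The net bound is used twice, for the functionals `⟪L v, ·⟫` with `v` in the net and then for
`L`; each use costs a factor 2. -/
lemma abs_quadratic_le_of_half_net {p : ℕ} {N : Finset (EuclideanSpace ℝ (Fin p))}
    (hN : ∀ u, ‖u‖ ≤ 1 → ∃ v ∈ N, ‖u - v‖ ≤ 1 / 2) (W : Matrix (Fin p) (Fin p) ℝ) {ε : ℝ}
    (hε : 0 ≤ ε) (hW : ∀ u ∈ N, ∀ v ∈ N, |u.ofLp ⬝ᵥ W *ᵥ v.ofLp| ≤ ε) (u : Fin p → ℝ) :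
    |u ⬝ᵥ W *ᵥ u| ≤ 4 * ε * (u ⬝ᵥ u) := by
  set L := toEuclideanCLM (𝕜 := ℝ) W
  have hin : ∀ u v, ⟪u, L v⟫ = u.ofLp ⬝ᵥ W *ᵥ v.ofLp := fun u v => by
    simp [L, inner_toEuclideanCLM]
  have h1 : ∀ v ∈ N, ‖L v‖ ≤ 2 * ε := fun v hv => by
    rw [← innerSL_apply_norm ℝ (L v)]
    refine norm_le_of_half_net hN _ hε fun u hu => ?_
    rw [innerSL_apply_apply, real_inner_comm, hin, Real.norm_eq_abs]
    exact hW u hu v hv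
  have h2 : ‖L‖ ≤ 4 * ε := (norm_le_of_half_net hN L (by positivity) h1).trans (by linarith)
  have h3 := abs_real_inner_le_norm (WithLp.toLp 2 u) (L (WithLp.toLp 2 u))
  have h4 : ‖WithLp.toLp 2 u‖ ^ 2 = u ⬝ᵥ u := by
    rw [EuclideanSpace.real_norm_sq_eq]
    simp [dotProduct, sq]
  rw [hin] at h3
  refine h3.trans ?_
  rw [← h4]
  have := L.le_opNorm (WithLp.toLp 2 u)
  nlinarith [norm_nonneg (WithLp.toLp 2 u),
    mul_le_mul_of_nonneg_right h2 (sq_nonneg ‖WithLp.toLp 2 u‖),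
    mul_le_mul_of_nonneg_left this (norm_nonneg (WithLp.toLp 2 u))]

end Net

/-! ### Exact recovery on the near-isometry event. -/

section Deterministic

variable {n p : ℕ} {G : Partition p} {H F : Type*} [NormedAddCommGroup H] [InnerProductSpace ℝ H]
  [NormedAddCommGroup F] [InnerProductSpace ℝ F] {z e : Fin p → H} {γ δ : ℝ} {T : H →ₗ[ℝ] F}

/-- The fluctuations of the empirical covariance of the errors. -/
def errorFluct (T : H →ₗ[ℝ] F) (e : Fin p → H) : Matrix (Fin p) (Fin p) ℝ :=
  of fun a b => ⟪T (e a), T (e b)⟫ - ⟪e a, e b⟫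

lemma LatentVectors.norm_sq_sum_error_le (h : LatentVectors G z e γ) (s : Finset (Fin p)) :
    ‖∑ c ∈ s, e c‖ ^ 2 ≤ s.card * γ := by
  rw [← real_inner_self_eq_norm_sq, sum_inner, ← nsmul_eq_mul]
  refine Finset.sum_le_card_nsmul _ _ _ fun a ha => ?_
  rw [inner_sum, Finset.sum_eq_single_of_mem a ha fun b _ hb => h.inner_error a b hb.symm,
    real_inner_self_eq_norm_sq]
  exact h.norm_sq_error_le a

lemma LatentVectors.norm_sq_combination_le (h : LatentVectors G z e γ) (u : Fin p → ℝ) :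
    ‖∑ a, u a • e a‖ ^ 2 ≤ γ * (u ⬝ᵥ u) := by
  rw [← real_inner_self_eq_norm_sq, sum_inner, dotProduct, Finset.mul_sum]
  refine Finset.sum_le_sum fun a _ => ?_
  rw [inner_sum, Finset.sum_eq_single_of_mem a (Finset.mem_univ a), real_inner_smul_left,
    real_inner_smul_right, real_inner_self_eq_norm_sq]
  · nlinarith [h.norm_sq_error_le a, mul_le_mul_of_nonneg_right (h.norm_sq_error_le a)
      (mul_self_nonneg (u a))]
  · intro b _ hb
    rw [real_inner_smul_left, real_inner_smul_right, h.inner_error a b hb.symm, mul_zero, mul_zero]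

lemma dotProduct_errorFluct_mulVec (u v : Fin p → ℝ) :
    u ⬝ᵥ errorFluct T e *ᵥ v = ⟪T (∑ a, u a • e a), T (∑ a, v a • e a)⟫
      - ⟪∑ a, u a • e a, ∑ a, v a • e a⟫ := by
  simp only [map_sum, map_smul, sum_inner, inner_sum, real_inner_smul_left, real_inner_smul_right,
    dotProduct, mulVec, errorFluct, of_apply, Finset.mul_sum, ← Finset.sum_sub_distrib]
  rw [Finset.sum_comm]
  exact Finset.sum_congr rfl fun a _ => Finset.sum_congr rfl fun b _ => by ring

lemma abs_quadratic_errorFluct_le (h : LatentVectors G z e γ)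
    {N : Finset (EuclideanSpace ℝ (Fin p))} (hγ : 0 ≤ γ) {ε : ℝ} (hε : 0 ≤ ε)
    (hN1 : ∀ v ∈ N, ‖v‖ ≤ 1) (hN : ∀ u, ‖u‖ ≤ 1 → ∃ v ∈ N, ‖u - v‖ ≤ 1 / 2)
    (hT : ∀ u ∈ N, ∀ v ∈ N, NearIsometry T ε (∑ a, u a • e a) (∑ a, v a • e a))
    (u : Fin p → ℝ) :
    |u ⬝ᵥ errorFluct T e *ᵥ u| ≤ 4 * (ε * γ) * (u ⬝ᵥ u) := by
  refine abs_quadratic_le_of_half_net hN _ (by positivity) (fun v hv w hw => ?_) u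
  have key : ∀ v ∈ N, ‖∑ a, v a • e a‖ ^ 2 ≤ γ := fun v hv => by
    refine (h.norm_sq_combination_le v.ofLp).trans ?_
    have : v.ofLp ⬝ᵥ v.ofLp = ‖v‖ ^ 2 := by
      rw [EuclideanSpace.real_norm_sq_eq]
      simp [dotProduct, sq]
    rw [this]
    exact mul_le_of_le_one_right hγ (pow_le_one₀ (norm_nonneg _) (hN1 v hv))
  rw [dotProduct_errorFluct_mulVec]
  refine (hT v hv w hw).trans (mul_le_mul_of_nonneg_left ?_ hε)
  nlinarith [key v hv, key w hw, sq_nonneg (‖∑ a, v a • e a‖ - ‖∑ a, w a • e a‖)]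

/-- The mean of k orthogonal errors has norm at most √(γ/k): this is the gain from averaging over a
group. -/
lemma abs_partnership_mul_errorFluct_le (h : LatentVectors G z e γ) (hδ : 0 ≤ δ)
    (hm : 0 < minSize G)
    (hT : ∀ a b, NearIsometry T δ (∑ c ∈ G.part a, e c) (e b)) (a b : Fin p) :
    |(partnership G * errorFluct T e) a b| ≤ δ * γ / √(minSize G) := by
  have hγ := h.nonneg a
  have hk := card_part_pos (G := G) a
  have hmk : (minSize G : ℝ) ≤ (G.part a).card := by exact_mod_cast minSize_le_card_part a
  have hm' : (0 : ℝ) < minSize G := by exact_mod_cast hm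
  have h1 : (partnership G * errorFluct T e) a b = ((G.part a).card : ℝ)⁻¹ *
      (⟪T (∑ c ∈ G.part a, e c), T (e b)⟫ - ⟪∑ c ∈ G.part a, e c, e b⟫) := by
    rw [mul_apply, sum_partnership_mul, map_sum, sum_inner, sum_inner, ← Finset.sum_sub_distrib]
    rfl
  have h2 : ‖∑ c ∈ G.part a, e c‖ * ‖e b‖ ≤ √(G.part a).card * γ := by
    refine (abs_le_of_sq_le_sq' ?_ (by positivity)).2
    rw [mul_pow, mul_pow, Real.sq_sqrt hk.le, sq γ, ← mul_assoc]
    exact mul_le_mul (h.norm_sq_sum_error_le _) (h.norm_sq_error_le b) (by positivity)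
      (by positivity)
  rw [h1, abs_mul, abs_of_pos (inv_pos.2 hk)]
  calc ((G.part a).card : ℝ)⁻¹ * _ ≤ ((G.part a).card : ℝ)⁻¹ * (δ * (√(G.part a).card * γ)) :=
        mul_le_mul_of_nonneg_left ((hT a b).trans (mul_le_mul_of_nonneg_left h2 hδ))
          (inv_nonneg.2 hk.le)
    _ = δ * γ / √(G.part a).card := by
        have hs := Real.sqrt_pos.2 hk
        nth_rewrite 1 [← Real.mul_self_sqrt hk.le]
        field_simp
    _ ≤ δ * γ / √(minSize G) := by gcongr

/-- On an event where `T` is a near isometry on the relevant vectors, PECOK recovers the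
partnership matrix. -/
theorem eq_partnership_of_isPecokOutput (hn : 0 < n) (hp : 0 < p) {D : Matrix (Fin n) (Fin p) ℝ}
    (hD : ∀ a b, sampleCov D a b = ⟪T (z a + e a), T (z b + e b)⟫) (h : LatentVectors G z e γ)
    (hm : 3 ≤ minSize G) (hδ : 0 ≤ δ) (hδ' : δ ≤ 1 / 10)
    (hTx : ∀ a b c d, NearIsometry T δ ((z a + e a) - (z b + e b)) ((z c + e c) - (z d + e d)))
    (hTz : ∀ a b, NearIsometry T δ (z a - z b) (z a - z b))
    (hTze : ∀ a b c, NearIsometry T δ (z a - z b) (e c))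
    (hTs : ∀ a b, NearIsometry T δ (∑ c ∈ G.part a, e c) (e b))
    {N : Finset (EuclideanSpace ℝ (Fin p))} {ε : ℝ} (hε : 0 ≤ ε)
    (hN1 : ∀ v ∈ N, ‖v‖ ≤ 1) (hN : ∀ u, ‖u‖ ≤ 1 → ∃ v ∈ N, ‖u - v‖ ≤ 1 / 2)
    (hTN : ∀ u ∈ N, ∀ v ∈ N, NearIsometry T ε (∑ a, u a • e a) (∑ a, v a • e a))
    {Δ : ℝ} (hΔ : 0 < Δ) (hsep : ∀ a b, group G a ≠ group G b → Δ ≤ ‖z a - z b‖ ^ 2)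
    (hΔ1 : 50 * (δ ^ 2 * γ) ≤ Δ)
    (hΔ2 : 6 * (14 * (δ * γ) / √(minSize G)) + (4 * (ε * γ) + 13 * (δ * γ)) / minSize G < Δ / 8)
    {B : Matrix (Fin p) (Fin p) ℝ} (hB : IsPecokOutput G.parts.card D B) : B = partnership G := by
  obtain ⟨ne₁, ne₂, hne, hBf, hmax⟩ := hB
  have hγ : 0 ≤ γ := h.nonneg ⟨0, hp⟩
  have hm0 : 0 < minSize G := by omega
  have hm' : (0 : ℝ) < minSize G := by exact_mod_cast hm0
  have hm1 : (1 : ℝ) ≤ minSize G := by exact_mod_cast hm0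
  have hoff := offMass_nonneg (G := G) hBf
  rcases hoff.eq_or_lt with h0 | h0
  · exact eq_partnership_of_offMass_eq_zero hBf hm0 h0.symm
  exfalso
  set A := partnership G with hA
  set d : Fin p → ℝ := fun a => ‖e a‖ ^ 2 - gammaHat D ne₁ ne₂ a a with hd
  have hdle : ∀ a, |d a| ≤ 13 * (δ * γ) := fun a => by
    rw [hd, abs_sub_comm]
    exact abs_gammaHat_sub_le hn hD h hm hδ hδ' hTx hne a
  set W := errorFluct T e + diagonal d with hW
  -- Polarization writes the latent and cross terms as `- w a b + f a + f b`, where `w` depends on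
  -- `z` only through `z a - z b` and so vanishes inside groups.
  set w : Fin p → Fin p → ℝ := fun a b =>
    ‖T (z a - z b)‖ ^ 2 / 2 + ⟪T (z a - z b), T (e a - e b)⟫ with hw
  set f : Fin p → ℝ := fun a => ‖T (z a)‖ ^ 2 / 2 + ⟪T (z a), T (e a)⟫ with hf
  have hentry : ∀ a b, (sampleCov D - gammaHat D ne₁ ne₂) a b = W a b - w a b + f a + f b := by
    intro a b
    have hdiag : gammaHat D ne₁ ne₂ a b = ⟪e a, e b⟫ - diagonal d a b := by
      by_cases hab : a = b
      · subst hab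
        rw [diagonal_apply_eq, real_inner_self_eq_norm_sq, hd]
        ring
      · rw [diagonal_apply_ne _ hab, h.inner_error a b hab, gammaHat, diagonal_apply_ne _ hab,
          sub_zero]
    rw [Matrix.sub_apply, hD, hdiag, hW, Matrix.add_apply, errorFluct, of_apply]
    simp only [hw, hf, map_add, map_sub, inner_add_left, inner_add_right, inner_sub_left,
      inner_sub_right, ← real_inner_self_eq_norm_sq]
    rw [real_inner_comm (T (z a)) (T (z b)), real_inner_comm (T (z b)) (T (e a))]
    ring
  have hrow : ∀ a, ∑ b, (A - B) a b = 0 := fun a => by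
    simp only [Matrix.sub_apply, Finset.sum_sub_distrib]
    rw [hA, sum_partnership, sum_feasible hBf, sub_self]
  have hcol : ∀ b, ∑ a, (A - B) a b = 0 := fun b => by
    simp only [Matrix.sub_apply, Finset.sum_sub_distrib]
    rw [hA, sum_partnership', hBf.2.1, sub_self]
  have hfrob : frob (sampleCov D - gammaHat D ne₁ ne₂) (A - B)
      = frob W (A - B) - ∑ a, ∑ b, w a b * (A - B) a b := by
    have e1 : ∑ a, ∑ b, f a * (A - B) a b = 0 := by
      simp only [← Finset.mul_sum, hrow, mul_zero, Finset.sum_const_zero]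
    have e2 : ∑ a, ∑ b, f b * (A - B) a b = 0 := by
      rw [Finset.sum_comm]
      simp only [← Finset.mul_sum, hcol, mul_zero, Finset.sum_const_zero]
    simp only [frob, hentry, add_mul, sub_mul, Finset.sum_add_distrib, Finset.sum_sub_distrib, e1,
      e2, add_zero]
  -- Across groups `A a b = 0`, so it suffices that `w a b ≥ Δ / 8`. In units of ‖z a - z b‖², w is
  -- at least 9/20 - 2 · 3/20 = 3/20.
  have hsignal : Δ / 8 * offMass G B ≤ - ∑ a, ∑ b, w a b * (A - B) a b := by
    rw [offMass, Finset.mul_sum, ← Finset.sum_neg_distrib]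
    refine Finset.sum_le_sum fun a _ => ?_
    rw [Finset.mul_sum, ← Finset.sum_neg_distrib]
    refine Finset.sum_le_sum fun b _ => ?_
    split_ifs with hg
    · simp only [hw]
      rw [h.eq_of_group_eq a b hg]
      simp
    · rw [Matrix.sub_apply, hA, partnership_of_ne hg, zero_sub, mul_neg, neg_neg]
      refine mul_le_mul_of_nonneg_right ?_ (hBf.2.2.1 a b)
      have s0 := hsep a b hg
      have s1 := (hTz a b).le_norm_sq
      have s2 := (abs_le.1 ((hTze a b a).abs_inner_le (by
        rw [inner_sub_left, h.inner_latent_error, h.inner_latent_error, sub_self]))).1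
      have s3 := (abs_le.1 ((hTze a b b).abs_inner_le (by
        rw [inner_sub_left, h.inner_latent_error, h.inner_latent_error, sub_self]))).2
      have s4 : ∀ c, δ * (‖z a - z b‖ * ‖e c‖) ≤ 3 / 20 * ‖z a - z b‖ ^ 2 := fun c => by
        -- This is what `hΔ1` is for: δ²γ ≤ Δ/50, and 1/50 ≤ (3/20)².
        have q : δ * ‖e c‖ ≤ 3 / 20 * ‖z a - z b‖ := by
          refine (abs_le_of_sq_le_sq' ?_ (by positivity)).2
          rw [mul_pow, mul_pow]
          nlinarith [mul_le_mul_of_nonneg_left (h.norm_sq_error_le c) (sq_nonneg δ)]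
        nlinarith [mul_le_mul_of_nonneg_left q (norm_nonneg (z a - z b))]
      simp only [hw]
      rw [map_sub T (e a), inner_sub_right]
      nlinarith [s4 a, s4 b, mul_nonneg (sub_nonneg.2 hδ') (sq_nonneg ‖z a - z b‖)]
  have hWt : Wᵀ = W := by
    rw [hW, transpose_add, diagonal_transpose]
    congr 1
    ext a b
    simp only [errorFluct, transpose_apply, of_apply]
    rw [real_inner_comm (T (e a)), real_inner_comm (e a)]
  have hsq : √(minSize G : ℝ) ≤ minSize G := by
    rw [Real.sqrt_le_left hm'.le]
    nlinarith
  have hWavg : ∀ a b, |(A * W) a b| ≤ 14 * (δ * γ) / √(minSize G) := by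
    intro a b
    rw [hW, mul_add, Matrix.add_apply, mul_diagonal]
    refine (abs_add_le _ _).trans ?_
    have q1 := abs_partnership_mul_errorFluct_le h hδ hm0 hTs a b
    have q2 : |A a b * d b| ≤ 13 * (δ * γ) / √(minSize G) := by
      rw [abs_mul, div_eq_inv_mul]
      refine mul_le_mul ?_ (hdle b) (abs_nonneg _) (by positivity)
      rw [hA, abs_of_nonneg (partnership_nonneg a b)]
      by_cases hg : group G a = group G b
      · rw [partnership_of_eq hg]
        gcongr
        exact hsq.trans (by exact_mod_cast minSize_le_card_part a)
      · rw [partnership_of_ne hg]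
        positivity
    calc _ ≤ δ * γ / √(minSize G) + 13 * (δ * γ) / √(minSize G) := add_le_add q1 q2
      _ = _ := by ring
  have hWop : ∀ u : Fin p → ℝ, |u ⬝ᵥ W *ᵥ u| ≤ (4 * (ε * γ) + 13 * (δ * γ)) * (u ⬝ᵥ u) := by
    intro u
    rw [hW, add_mulVec, dotProduct_add, add_mul]
    refine (abs_add_le _ _).trans (add_le_add
      (abs_quadratic_errorFluct_le h hγ hε hN1 hN hTN u) ?_)
    rw [dotProduct, dotProduct, Finset.mul_sum]
    refine (Finset.abs_sum_le_sum_abs _ _).trans (Finset.sum_le_sum fun a _ => ?_)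
    rw [mulVec_diagonal, abs_mul, abs_mul, mul_left_comm, ← abs_mul, abs_mul_self]
    exact mul_le_mul_of_nonneg_right (hdle a) (mul_self_nonneg _)
  have hnoise := abs_frob_sub_le hBf hm0 hWt hWavg (by positivity) hWop
  have hle : frob (sampleCov D - gammaHat D ne₁ ne₂) (A - B) ≤ 0 := by
    have : frob (sampleCov D - gammaHat D ne₁ ne₂) A ≤ frob (sampleCov D - gammaHat D ne₁ ne₂) B :=
      hmax (partnership_mem_feasible (G := G))
    rw [show frob (sampleCov D - gammaHat D ne₁ ne₂) (A - B) =
      frob (sampleCov D - gammaHat D ne₁ ne₂) A - frob (sampleCov D - gammaHat D ne₁ ne₂) B from ?_]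
    · linarith
    · simp only [frob, Matrix.sub_apply (A := A), mul_sub, Finset.sum_sub_distrib]
  have := mul_lt_mul_of_pos_right hΔ2 h0
  rw [hfrob] at hle
  linarith [(abs_le.1 hnoise).1]

end Deterministic

end Pecok

/-! ### Chi-square deviations. -/

namespace Pecok

open scoped RealInnerProductSpace

section ChiSquare

/-- Used at u = 2t, where the square root of the left side is the moment generating function of a
squared Gaussian. -/
lemma inv_one_sub_le_exp {u : ℝ} (h2 : u ≤ 1 / 4) :
    (1 - u)⁻¹ ≤ Real.exp (u + u ^ 2) := by
  rw [inv_le_iff_one_le_mul₀ (by linarith)]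
  rcases le_total 0 u with hu | hu
  · have h := Real.quadratic_le_exp_of_nonneg (by positivity : 0 ≤ u + u ^ 2)
    calc (1 : ℝ) ≤ (1 + (u + u ^ 2) + (u + u ^ 2) ^ 2 / 2) * (1 - u) := by
          nlinarith [mul_nonneg (mul_nonneg hu hu) (sub_nonneg.2 h2),
            mul_nonneg (mul_nonneg (mul_nonneg hu hu) hu) (sub_nonneg.2 h2), pow_nonneg hu 3,
            pow_nonneg hu 4, mul_nonneg (pow_nonneg hu 4) (sub_nonneg.2 h2)]
      _ ≤ _ := mul_le_mul_of_nonneg_right h (by linarith)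
  · have h := Real.add_one_le_exp (u + u ^ 2)
    calc (1 : ℝ) ≤ (u + u ^ 2 + 1) * (1 - u) := by
          nlinarith [mul_nonneg (neg_nonneg.2 hu) (mul_self_nonneg u)]
      _ ≤ _ := mul_le_mul_of_nonneg_right h (by linarith)

lemma gaussianPDFReal_mul_exp_sq (t x : ℝ) :
    gaussianPDFReal 0 1 x * Real.exp (t * (x ^ 2 - 1))
      = (√(2 * Real.pi))⁻¹ * Real.exp (-t) * Real.exp (-(1 / 2 - t) * x ^ 2) := by
  simp only [gaussianPDFReal, NNReal.coe_one, mul_one, sub_zero]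
  rw [mul_assoc, mul_assoc, ← Real.exp_add, ← Real.exp_add]
  congr 2
  ring

lemma integrable_exp_mul_sq_sub_one {t : ℝ} (ht : t < 1 / 2) :
    Integrable (fun x => Real.exp (t * (x ^ 2 - 1))) (gaussianReal 0 1) := by
  rw [gaussianReal_of_var_ne_zero _ one_ne_zero,
    integrable_withDensity_iff_integrable_smul' (measurable_gaussianPDF _ _)
      (ae_of_all _ fun _ => gaussianPDF_lt_top)]
  simp only [toReal_gaussianPDF, smul_eq_mul, gaussianPDFReal_mul_exp_sq]
  exact (integrable_exp_neg_mul_sq (by linarith)).const_mul _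

lemma mgf_sq_sub_one_le {t : ℝ} (ht : |t| ≤ 1 / 8) :
    mgf (fun x => x ^ 2 - 1) (gaussianReal 0 1) t ≤ Real.exp (2 * t ^ 2) := by
  obtain ⟨h1, h2⟩ := abs_le.1 ht
  have hpos : 0 < 1 / 2 - t := by linarith
  rw [mgf, integral_gaussianReal_eq_integral_smul one_ne_zero]
  simp only [smul_eq_mul, gaussianPDFReal_mul_exp_sq]
  rw [integral_const_mul, integral_gaussian]
  have h3 : (√(2 * Real.pi))⁻¹ * Real.exp (-t) * √(Real.pi / (1 / 2 - t))
      = Real.exp (-t) * √((1 - 2 * t)⁻¹) := by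
    rw [← Real.sqrt_inv, mul_comm _ (Real.exp (-t)), mul_assoc, ← Real.sqrt_mul (by positivity)]
    congr 2
    have := Real.pi_pos.ne'
    have : 1 - 2 * t ≠ 0 := by linarith
    field_simp
  rw [h3]
  have h4 : √((1 - 2 * t)⁻¹) ≤ Real.exp (t + 2 * t ^ 2) := by
    rw [Real.sqrt_le_left (Real.exp_pos _).le, ← Real.exp_nat_mul]
    refine (inv_one_sub_le_exp (by linarith)).trans (Real.exp_le_exp.2 ?_)
    push_cast
    linarith
  calc _ ≤ Real.exp (-t) * Real.exp (t + 2 * t ^ 2) :=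
        mul_le_mul_of_nonneg_left h4 (Real.exp_pos _).le
    _ = _ := by rw [← Real.exp_add]; congr 1; ring

/-- The deviation level of a chi-square variable with `n` degrees of freedom. -/
noncomputable def chiDev (n x : ℝ) : ℝ := √(8 * n * x) + 16 * x

/-- With D = `chiDev n x`, the minimizer t = D/(4n) is admissible when D ≤ n/2, and D² ≥ 8nx
suffices. Otherwise t = 1/8 gives at most -D/16, and D ≥ 16x suffices. -/
lemma exists_chernoff_parameter {n x : ℝ} (hn : 0 < n) (hx : 0 ≤ x) :
    ∃ t, 0 ≤ t ∧ t ≤ 1 / 8 ∧ -t * chiDev n x + n * (2 * t ^ 2) ≤ -x := by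
  have h1 : 0 ≤ √(8 * n * x) := Real.sqrt_nonneg _
  have h2 : √(8 * n * x) ^ 2 = 8 * n * x := Real.sq_sqrt (by positivity)
  have h0 : 0 ≤ chiDev n x := by unfold chiDev; positivity
  rcases le_total (chiDev n x) (n / 2) with h | h
  · refine ⟨chiDev n x / (4 * n), by positivity, ?_, ?_⟩
    · rw [div_le_iff₀ (by positivity)]
      linarith
    · have h3 : 8 * n * x ≤ chiDev n x ^ 2 := by
        rw [← h2]
        exact pow_le_pow_left₀ h1 (by unfold chiDev; linarith) 2
      have h4 : -(chiDev n x / (4 * n)) * chiDev n x + n * (2 * (chiDev n x / (4 * n)) ^ 2)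
          = -(chiDev n x ^ 2 / (8 * n)) := by
        field_simp
        ring
      rw [h4, neg_le_neg_iff, le_div_iff₀ (by positivity)]
      linarith
  · refine ⟨1 / 8, by norm_num, le_rfl, ?_⟩
    have : 16 * x ≤ chiDev n x := by unfold chiDev; linarith
    linarith

end ChiSquare

/-! ### Concentration of empirical scalar products. -/

section Concentration

variable {n : ℕ} {H : Type*} [NormedAddCommGroup H] [InnerProductSpace ℝ H]

/-- The linear map `w ↦ n^{-1/2} (⟪w, ξ_i⟫)_i`. -/
noncomputable def empiricalMap (ξ : Fin n → H) : H →ₗ[ℝ] EuclideanSpace ℝ (Fin n) where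
  toFun w := WithLp.toLp 2 fun i => (√n)⁻¹ * ⟪w, ξ i⟫
  map_add' u v := by
    ext i
    simp [inner_add_left, mul_add]
  map_smul' c u := by
    ext i
    simp [real_inner_smul_left, mul_left_comm]

lemma inner_empiricalMap (ξ : Fin n → H) (u v : H) :
    ⟪empiricalMap ξ u, empiricalMap ξ v⟫ = (n : ℝ)⁻¹ * ∑ i, ⟪u, ξ i⟫ * ⟪v, ξ i⟫ := by
  have : (n : ℝ)⁻¹ = (√n)⁻¹ * (√n)⁻¹ := by
    rw [← mul_inv, Real.mul_self_sqrt n.cast_nonneg]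
  simp only [empiricalMap, LinearMap.coe_mk, AddHom.coe_mk, PiLp.inner_apply, Finset.mul_sum, this]
  refine Finset.sum_congr rfl fun i _ => ?_
  simp only [RCLike.inner_apply, conj_trivial]
  ring

lemma continuous_inner_empiricalMap (u v : H) :
    Continuous fun ξ : Fin n → H => ⟪empiricalMap ξ u, empiricalMap ξ v⟫ := by
  simp only [inner_empiricalMap]
  fun_prop

lemma isClosed_nearIsometry (δ : ℝ) (u v : H) :
    IsClosed {ξ : Fin n → H | NearIsometry (empiricalMap ξ) δ u v} :=
  isClosed_le ((continuous_inner_empiricalMap u v).sub continuous_const).abs continuous_const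

lemma NearIsometry.smul {F : Type*} [NormedAddCommGroup F] [InnerProductSpace ℝ F]
    {T : H →ₗ[ℝ] F} {δ : ℝ} {u v : H} (h : NearIsometry T δ u v) (c d : ℝ) :
    NearIsometry T δ (c • u) (d • v) := by
  simp only [NearIsometry, map_smul, real_inner_smul_left, real_inner_smul_right, norm_smul,
    Real.norm_eq_abs, ← mul_sub, abs_mul] at h ⊢
  calc _ ≤ |d| * (|c| * (δ * (‖u‖ * ‖v‖))) := by gcongr
    _ = _ := by ring

/-- By the parallelogram law the two errors add up to 4δ, exactly the factor in 4⟪u, v⟫, so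
polarization loses nothing. -/
lemma NearIsometry.of_polarization {F : Type*} [NormedAddCommGroup F] [InnerProductSpace ℝ F]
    {T : H →ₗ[ℝ] F} {δ : ℝ} {u v : H} (hu : ‖u‖ = 1) (hv : ‖v‖ = 1)
    (h1 : NearIsometry T δ (u + v) (u + v)) (h2 : NearIsometry T δ (u - v) (u - v)) :
    NearIsometry T δ u v := by
  have hp : ‖u + v‖ * ‖u + v‖ + ‖u - v‖ * ‖u - v‖ = 4 := by
    rw [← sq, ← sq, parallelogram_law_with_norm ℝ, hu, hv]
    norm_num
  have a1 := abs_le.1 h1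
  have a2 := abs_le.1 h2
  have b1 : ⟪u + v, u + v⟫ - ⟪u - v, u - v⟫ = 4 * ⟪u, v⟫ := by
    rw [real_inner_add_add_self, real_inner_sub_sub_self]
    ring
  have b2 : ⟪T (u + v), T (u + v)⟫ - ⟪T (u - v), T (u - v)⟫ = 4 * ⟪T u, T v⟫ := by
    rw [map_add, map_sub, real_inner_add_add_self, real_inner_sub_sub_self]
    ring
  have hp' : δ * (‖u + v‖ * ‖u + v‖) + δ * (‖u - v‖ * ‖u - v‖) = 4 * δ := by
    rw [← mul_add, hp, mul_comm]
  rw [NearIsometry, hu, hv, abs_le]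
  constructor <;> linarith [a1.1, a1.2, a2.1, a2.2]

lemma nearIsometry_zero_left {F : Type*} [NormedAddCommGroup F] [InnerProductSpace ℝ F]
    (T : H →ₗ[ℝ] F) (δ : ℝ) (v : H) : NearIsometry T δ 0 v := by
  simp [NearIsometry]

lemma nearIsometry_zero_right {F : Type*} [NormedAddCommGroup F] [InnerProductSpace ℝ F]
    (T : H →ₗ[ℝ] F) (δ : ℝ) (v : H) : NearIsometry T δ v 0 := by
  simp [NearIsometry]

variable [FiniteDimensional ℝ H] [MeasurableSpace H] [BorelSpace H]

lemma stdGaussian_map_inner {w : H} (hw : ‖w‖ = 1) :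
    (stdGaussian H).map (fun x => ⟪w, x⟫) = gaussianReal 0 1 := by
  have h := IsGaussian.map_eq_gaussianReal (μ := stdGaussian H) (innerSL ℝ w)
  rw [integral_strongDual_stdGaussian, variance_dual_stdGaussian, innerSL_apply_norm, hw] at h
  simpa using h

variable (n H) in
/-- The law of `n` independent standard Gaussian vectors of `H`. -/
noncomputable abbrev stdSample : Measure (Fin n → H) := Measure.pi fun _ => stdGaussian H

lemma stdSample_real_chi_le (hn : 0 < n) {w : H} (hw : ‖w‖ = 1) {x : ℝ} (hx : 0 ≤ x) :
    (stdSample n H).real {ξ | chiDev n x ≤ |∑ i, (⟪w, ξ i⟫ ^ 2 - 1)|} ≤ 2 * Real.exp (-x) := by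
  have hn' : (0 : ℝ) < n := by exact_mod_cast hn
  obtain ⟨t, ht0, ht1, ht⟩ := exists_chernoff_parameter hn' hx
  set Y : Fin n → (Fin n → H) → ℝ := fun i ξ => ⟪w, ξ i⟫ ^ 2 - 1 with hY
  have hmeas : ∀ i, Measurable (Y i) := fun i => by fun_prop
  have hind : iIndepFun Y (stdSample n H) :=
    iIndepFun_pi (X := fun _ y => ⟪w, y⟫ ^ 2 - 1) fun i => by fun_prop
  have hmap : ∀ i, (stdSample n H).map (fun ξ => ⟪w, ξ i⟫) = gaussianReal 0 1 := fun i => by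
    rw [← stdGaussian_map_inner hw,
      ← (measurePreserving_eval (fun _ : Fin n => stdGaussian H) i).map_eq,
      Measure.map_map (by fun_prop) (by fun_prop)]
    rfl
  have hint : ∀ s, |s| ≤ 1 / 8 → ∀ i, Integrable (fun ξ => Real.exp (s * Y i ξ)) (stdSample n H) :=
    fun s hs i => by
      have h := integrable_exp_mul_sq_sub_one (t := s) (by linarith [(abs_le.1 hs).2])
      rw [← hmap i] at h
      exact h.comp_measurable (by fun_prop : Measurable fun ξ : Fin n → H => ⟪w, ξ i⟫)
  have hmgf : ∀ s, |s| ≤ 1 / 8 → mgf (∑ i, Y i) (stdSample n H) s ≤ Real.exp (n * (2 * s ^ 2)) :=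
    fun s hs => by
      rw [hind.mgf_sum hmeas]
      have h : ∀ i, mgf (Y i) (stdSample n H) s ≤ Real.exp (2 * s ^ 2) := fun i => by
        refine le_of_eq_of_le ?_ (mgf_sq_sub_one_le hs)
        rw [← hmap i, mgf_map (by fun_prop : Measurable fun ξ : Fin n → H => ⟪w, ξ i⟫).aemeasurable
          (by fun_prop)]
        rfl
      refine (Finset.prod_le_prod (fun _ _ => mgf_nonneg) fun i _ => h i).trans ?_
      rw [Finset.prod_const, Finset.card_univ, Fintype.card_fin, ← Real.exp_nat_mul]
  have hsum : ∀ ξ, ∑ i, (⟪w, ξ i⟫ ^ 2 - 1) = (∑ i, Y i) ξ := fun ξ => by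
    rw [Finset.sum_apply]
  have ht8 : |t| ≤ 1 / 8 := by rwa [abs_of_nonneg ht0]
  have ht8' : |-t| ≤ 1 / 8 := by rwa [abs_neg]
  have hup := measure_ge_le_exp_mul_mgf (μ := stdSample n H) (X := ∑ i, Y i) (chiDev n x) ht0
    (hind.integrable_exp_mul_sum hmeas fun i _ => hint t ht8 i)
  have hlow := measure_le_le_exp_mul_mgf (μ := stdSample n H) (X := ∑ i, Y i) (-chiDev n x)
    (neg_nonpos.2 ht0) (hind.integrable_exp_mul_sum hmeas fun i _ => hint (-t) ht8' i)
  have hexp : Real.exp (-t * chiDev n x) * Real.exp (n * (2 * t ^ 2)) ≤ Real.exp (-x) := by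
    rw [← Real.exp_add]
    exact Real.exp_le_exp.2 ht
  have h1 := hup.trans ((mul_le_mul_of_nonneg_left (hmgf t ht8) (Real.exp_pos _).le).trans hexp)
  have h2 := hlow.trans ((mul_le_mul_of_nonneg_left (hmgf (-t) ht8') (Real.exp_pos _).le).trans
    (by simpa using hexp))
  have hsub : {ξ : Fin n → H | chiDev n x ≤ |∑ i, (⟪w, ξ i⟫ ^ 2 - 1)|} ⊆
      {ξ | chiDev n x ≤ (∑ i, Y i) ξ} ∪ {ξ | (∑ i, Y i) ξ ≤ -chiDev n x} := by
    intro ξ hξ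
    rw [Set.mem_ofPred_eq, hsum, le_abs] at hξ
    exact hξ.imp id fun h => by rw [Set.mem_ofPred_eq]; linarith
  calc _ ≤ _ := measureReal_mono hsub
    _ ≤ _ := measureReal_union_le _ _
    _ ≤ 2 * Real.exp (-x) := by linarith

lemma stdSample_not_nearIsometry_self_le (hn : 0 < n) (w : H) {x : ℝ} (hx : 0 ≤ x) :
    (stdSample n H).real {ξ | ¬ NearIsometry (empiricalMap ξ) (chiDev n x / n) w w}
      ≤ 2 * Real.exp (-x) := by
  have hn' : (0 : ℝ) < n := by exact_mod_cast hn
  by_cases hw : w = 0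
  · simp only [hw, nearIsometry_zero_left, not_true_eq_false, Set.ofPred_false, measureReal_empty]
    positivity
  have hw' : ‖w‖ ≠ 0 := norm_ne_zero_iff.2 hw
  set v := ‖w‖⁻¹ • w with hv
  have hv1 : ‖v‖ = 1 := by rw [hv, norm_smul, norm_inv, norm_norm, inv_mul_cancel₀ hw']
  refine (measureReal_mono fun ξ hξ => ?_).trans (stdSample_real_chi_le hn hv1 hx)
  rw [Set.mem_ofPred_eq] at hξ ⊢
  contrapose! hξ
  have hwv : w = ‖w‖ • v := by rw [hv, smul_inv_smul₀ hw']
  rw [hwv]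
  refine NearIsometry.smul ?_ _ _
  rw [NearIsometry, inner_empiricalMap, real_inner_self_eq_norm_sq, hv1, mul_one, mul_one,
    le_div_iff₀ hn']
  have : ∑ i, (⟪v, ξ i⟫ ^ 2 - 1) = ((n : ℝ)⁻¹ * ∑ i, ⟪v, ξ i⟫ * ⟪v, ξ i⟫ - 1 ^ 2) * n := by
    rw [Finset.sum_sub_distrib, sub_mul, mul_comm _ (n : ℝ), mul_inv_cancel_left₀ hn'.ne']
    simp [sq]
  rw [this, abs_mul, abs_of_pos hn'] at hξ
  exact hξ.le

/-- The sample scalar product of two fixed directions concentrates. -/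
lemma stdSample_not_nearIsometry_le (hn : 0 < n) (u v : H) {x : ℝ} (hx : 0 ≤ x) :
    (stdSample n H).real {ξ | ¬ NearIsometry (empiricalMap ξ) (chiDev n x / n) u v}
      ≤ 4 * Real.exp (-x) := by
  by_cases hu : u = 0
  · simp only [hu, nearIsometry_zero_left, not_true_eq_false, Set.ofPred_false, measureReal_empty]
    positivity
  by_cases hv : v = 0
  · simp only [hv, nearIsometry_zero_right, not_true_eq_false, Set.ofPred_false, measureReal_empty]
    positivity
  have hu' : ‖u‖ ≠ 0 := norm_ne_zero_iff.2 hu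
  have hv' : ‖v‖ ≠ 0 := norm_ne_zero_iff.2 hv
  set r := ‖u‖⁻¹ • u with hr
  set s := ‖v‖⁻¹ • v with hs
  have hr1 : ‖r‖ = 1 := by rw [hr, norm_smul, norm_inv, norm_norm, inv_mul_cancel₀ hu']
  have hs1 : ‖s‖ = 1 := by rw [hs, norm_smul, norm_inv, norm_norm, inv_mul_cancel₀ hv']
  have h1 := stdSample_not_nearIsometry_self_le hn (r + s) hx
  have h2 := stdSample_not_nearIsometry_self_le hn (r - s) hx
  refine (measureReal_mono ?_).trans ((measureReal_union_le _ _).trans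
    ((add_le_add h1 h2).trans (by linarith)))
  intro ξ hξ
  by_contra hcon
  simp only [Set.mem_union, Set.mem_ofPred_eq, not_or, not_not] at hcon hξ
  refine hξ ?_
  have := (NearIsometry.of_polarization hr1 hs1 hcon.1 hcon.2).smul ‖u‖ ‖v‖
  rwa [hr, hs, smul_inv_smul₀ hu', smul_inv_smul₀ hv'] at this

end Concentration

end Pecok

/-! ### Hilbert space model of the latent decomposition and law of the data. -/

namespace Pecok

open scoped RealInnerProductSpace

section Law

lemma inner_toLp_eq_covariance {Ω : Type*} [MeasurableSpace Ω] {P : Measure Ω}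
    [IsProbabilityMeasure P] {f g : Ω → ℝ} (hf : MemLp f 2 P) (hg : MemLp g 2 P)
    (hf0 : ∫ ω, f ω ∂P = 0) : ⟪hf.toLp f, hg.toLp g⟫ = cov[f, g; P] := by
  rw [covariance_eq_sub hf hg, hf0, zero_mul, sub_zero, L2.inner_def]
  refine integral_congr_ae ?_
  filter_upwards [hf.coeFn_toLp, hg.coeFn_toLp] with ω h1 h2
  rw [h1, h2]
  simp [mul_comm]

/-- Finitely many vectors of an inner product space have an isometric copy in some `ℝ^q`. -/
lemma exists_isometric_copy {V ι : Type*} [NormedAddCommGroup V] [InnerProductSpace ℝ V]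
    [Finite ι] (v : ι → V) :
    ∃ (q : ℕ) (u : ι → EuclideanSpace ℝ (Fin q)), ∀ i j, ⟪u i, u j⟫ = ⟪v i, v j⟫ := by
  set S := Submodule.span ℝ (Set.range v)
  have : FiniteDimensional ℝ S := FiniteDimensional.span_of_finite ℝ (Set.finite_range v)
  refine ⟨Module.finrank ℝ S, fun i => (stdOrthonormalBasis ℝ S).repr
    ⟨v i, Submodule.subset_span ⟨i, rfl⟩⟩, fun i j => ?_⟩
  rw [LinearIsometryEquiv.inner_map_map, Submodule.coe_inner]

variable {p : ℕ} {G : Partition p} {Ω : Type*} [MeasurableSpace Ω] {P : Measure Ω}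
  {X : Ω → Fin p → ℝ} {Z : Ω → G.parts → ℝ} {E : Ω → Fin p → ℝ}

lemma LatentDecomposition.memLp (h : LatentDecomposition P G X Z E) (a : Fin p) :
    MemLp (fun ω => X ω a) 2 P :=
  ((h.memLp_latent (group G a)).add (h.memLp_error a)).ae_eq
    (h.eq_add.mono fun _ hω => (hω a).symm)

variable [IsProbabilityMeasure P]

lemma LatentDecomposition.mean (h : LatentDecomposition P G X Z E) (a : Fin p) :
    ∫ ω, X ω a ∂P = 0 := by
  rw [integral_congr_ae (h.eq_add.mono fun ω hω => hω a),
    integral_add ((h.memLp_latent _).integrable one_le_two)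
      ((h.memLp_error a).integrable one_le_two), h.mean_latent, h.mean_error, add_zero]

/-- The covariances of a latent decomposition are the scalar products of vectors of some `ℝ^q`. -/
lemma LatentDecomposition.exists_latentVectors (h : LatentDecomposition P G X Z E) :
    ∃ (q : ℕ) (z e : Fin p → EuclideanSpace ℝ (Fin q)),
      LatentVectors G z e (supNorm (covMatrix E P)) ∧
      (∀ a b, group G a ≠ group G b → separation (covMatrix Z P) ≤ ‖z a - z b‖ ^ 2) ∧
      ∀ a b, ⟪z a + e a, z b + e b⟫ = cov[fun ω => X ω a, fun ω => X ω b; P] := by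
  set zL : Fin p → Lp ℝ 2 P := fun a => (h.memLp_latent (group G a)).toLp _ with hzL
  set eL : Fin p → Lp ℝ 2 P := fun a => (h.memLp_error a).toLp _ with heL
  obtain ⟨q, u, hu⟩ := exists_isometric_copy (Sum.elim zL eL)
  have hzz : ∀ a b, ⟪u (Sum.inl a), u (Sum.inl b)⟫ = covMatrix Z P (group G a) (group G b) :=
    fun a b => (hu _ _).trans
      (inner_toLp_eq_covariance (h.memLp_latent _) (h.memLp_latent _) (h.mean_latent _))
  have hze : ∀ a b, ⟪u (Sum.inl a), u (Sum.inr b)⟫ = 0 := fun a b => by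
    refine (hu _ _).trans ((inner_toLp_eq_covariance (h.memLp_latent _)
      (h.memLp_error _) (h.mean_latent _)).trans ?_)
    exact (h.indep_latent_error.comp (measurable_pi_apply (group G a))
      (measurable_pi_apply b)).covariance_eq_zero (h.memLp_latent _) (h.memLp_error _)
  have hee : ∀ a b, ⟪u (Sum.inr a), u (Sum.inr b)⟫ = covMatrix E P a b :=
    fun a b => (hu _ _).trans
      (inner_toLp_eq_covariance (h.memLp_error _) (h.memLp_error _) (h.mean_error _))
  refine ⟨q, fun a => u (Sum.inl a), fun a => u (Sum.inr a), ⟨?_, hze, ?_, ?_⟩, ?_, ?_⟩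
  · intro a b hab
    rw [← sub_eq_zero, ← inner_self_eq_zero (𝕜 := ℝ)]
    simp only [inner_sub_left, inner_sub_right, hzz, hab]
    ring
  · intro a b hab
    rw [hee]
    exact (h.indep_error.indepFun hab).covariance_eq_zero (h.memLp_error _) (h.memLp_error _)
  · intro a
    rw [← real_inner_self_eq_norm_sq, hee]
    exact (le_abs_self _).trans
      (le_ciSup (f := fun ij : Fin p × Fin p => |covMatrix E P ij.1 ij.2|)
        (Set.finite_range _).bddAbove (a, a))
  · intro a b hab
    have hsymm : covMatrix Z P (group G b) (group G a) = covMatrix Z P (group G a) (group G b) :=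
      covariance_comm _ _
    rw [← real_inner_self_eq_norm_sq]
    simp only [inner_sub_left, inner_sub_right, hzz, hsymm]
    refine (ciInf_le (f := fun jk : {jk : G.parts × G.parts // jk.1 ≠ jk.2} =>
      covMatrix Z P jk.1.1 jk.1.1 + covMatrix Z P jk.1.2 jk.1.2 - 2 * covMatrix Z P jk.1.1 jk.1.2)
        (Set.finite_range _).bddBelow ⟨(group G a, group G b), hab⟩).trans_eq ?_
    ring
  · intro a b
    have hx : ∀ a, (h.memLp a).toLp _ = zL a + eL a := fun a => by
      rw [hzL, heL, ← MemLp.toLp_add]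
      exact MemLp.toLp_congr _ _ (h.eq_add.mono fun ω hω => hω a)
    rw [← inner_toLp_eq_covariance (h.memLp a) (h.memLp b) (h.mean a), hx, hx]
    simp only [inner_add_left, inner_add_right, hu, Sum.elim_inl, Sum.elim_inr]

/-- A centered Gaussian vector has the law of the coordinates of a standard Gaussian vector along
directions with the same Gram matrix. -/
lemma map_eq_map_stdGaussian {H : Type*} [NormedAddCommGroup H] [InnerProductSpace ℝ H]
    [FiniteDimensional ℝ H] [MeasurableSpace H] [BorelSpace H] (hX : HasGaussianLaw X P)
    (hmean : ∀ a, ∫ ω, X ω a ∂P = 0) {x : Fin p → H}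
    (hx : ∀ a b, ⟪x a, x b⟫ = cov[fun ω => X ω a, fun ω => X ω b; P]) :
    P.map X = (stdGaussian H).map (fun y a => ⟪x a, y⟫) := by
  have hXa : ∀ a, HasGaussianLaw (fun ω => X ω a) P := fun a => hX.eval a
  set A : H →L[ℝ] (Fin p → ℝ) := ContinuousLinearMap.pi fun a => innerSL ℝ (x a) with hA
  have hAeq : (fun y a => ⟪x a, y⟫ : H → Fin p → ℝ) = A := rfl
  rw [hAeq]
  have := hX.isGaussian_map
  -- Under both laws a linear functional with coefficients `l` is a centered real Gaussian of
  -- variance ‖∑ l a • x a‖².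
  refine Measure.ext_of_charFunDual ?_
  ext L
  set l : Fin p → ℝ := fun a => L (Pi.single a 1) with hl
  have hL : ∀ y, L y = ∑ a, l a * y a := fun y => by
    conv_lhs => rw [pi_eq_sum_univ' y]
    simp [hl, mul_comm]
  have hLX : ⇑L ∘ X = fun ω => ∑ a, l a * X ω a := funext fun ω => hL _
  have hLA : L ∘L A = innerSL ℝ (∑ a, l a • x a) := by
    ext y
    simp [hL, hA]
  have hmem : ∀ a, MemLp (fun ω => l a * X ω a) 2 P := fun a => (hXa a).memLp_two.const_mul _
  rw [hX.charFunDual_map_eq, charFunDual_map, hLA, charFunDual_stdGaussian, innerSL_apply_norm,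
    hLX]
  have h1 : ∫ ω, ∑ a, l a * X ω a ∂P = 0 := by
    rw [integral_finsetSum _ fun a _ => (hmem a).integrable one_le_two]
    simp [integral_const_mul, hmean]
  have h2 : Var[fun ω => ∑ a, l a * X ω a; P] = ‖∑ a, l a • x a‖ ^ 2 := by
    rw [variance_fun_sum hmem, ← real_inner_self_eq_norm_sq]
    simp only [sum_inner, inner_sum, real_inner_smul_left, real_inner_smul_right, hx,
      covariance_const_mul_left, covariance_const_mul_right]
    rw [Finset.sum_comm]
  rw [h1, h2]
  simp [neg_div]

end Law

end Pecok

/-! ### Probability of the good event. -/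

namespace Pecok

open scoped RealInnerProductSpace

section GoodEvent

variable {n p : ℕ} {G : Partition p} {H : Type*} [NormedAddCommGroup H] [InnerProductSpace ℝ H]

/-- The samples that are near isometries along all pairs of a family. -/
def nearIsometrySet {ι : Type*} (n : ℕ) (δ : ℝ) (u v : ι → H) : Set (Fin n → H) :=
  ⋂ i, {ξ | NearIsometry (empiricalMap ξ) δ (u i) (v i)}

lemma isClosed_nearIsometrySet {ι : Type*} (δ : ℝ) (u v : ι → H) :
    IsClosed (nearIsometrySet n δ u v) :=
  isClosed_iInter fun _ => isClosed_nearIsometry _ _ _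

lemma mem_nearIsometrySet {ι : Type*} {δ : ℝ} {u v : ι → H} {ξ : Fin n → H} :
    ξ ∈ nearIsometrySet n δ u v ↔ ∀ i, NearIsometry (empiricalMap ξ) δ (u i) (v i) :=
  Set.mem_iInter

/-- The samples on which PECOK succeeds. -/
def goodSet (n : ℕ) (G : Partition p) (z e : Fin p → H) (N : Finset (EuclideanSpace ℝ (Fin p)))
    (δ ε : ℝ) : Set (Fin n → H) :=
  nearIsometrySet n δ (fun i : (Fin p × Fin p) × Fin p × Fin p =>
      (z i.1.1 + e i.1.1) - (z i.1.2 + e i.1.2)) (fun i => (z i.2.1 + e i.2.1) - (z i.2.2 + e i.2.2))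
  ∩ nearIsometrySet n δ (fun i : Fin p × Fin p => z i.1 - z i.2) (fun i => z i.1 - z i.2)
  ∩ nearIsometrySet n δ (fun i : (Fin p × Fin p) × Fin p => z i.1.1 - z i.1.2) (fun i => e i.2)
  ∩ nearIsometrySet n δ (fun i : Fin p × Fin p => ∑ c ∈ G.part i.1, e c) (fun i => e i.2)
  ∩ nearIsometrySet n ε (fun i : N × N => ∑ a, i.1.1 a • e a) (fun i => ∑ a, i.2.1 a • e a)

lemma isClosed_goodSet (z e : Fin p → H) (N : Finset (EuclideanSpace ℝ (Fin p))) (δ ε : ℝ) :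
    IsClosed (goodSet n G z e N δ ε) :=
  ((((isClosed_nearIsometrySet _ _ _).inter (isClosed_nearIsometrySet _ _ _)).inter
    (isClosed_nearIsometrySet _ _ _)).inter (isClosed_nearIsometrySet _ _ _)).inter
    (isClosed_nearIsometrySet _ _ _)

variable [FiniteDimensional ℝ H] [MeasurableSpace H] [BorelSpace H]

lemma stdSample_nearIsometrySet_compl_le (hn : 0 < n) {ι : Type*} [Fintype ι] (u v : ι → H) {x : ℝ}
    (hx : 0 ≤ x) : (stdSample n H).real (nearIsometrySet n (chiDev n x / n) u v)ᶜ
      ≤ Fintype.card ι * (4 * Real.exp (-x)) := by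
  rw [nearIsometrySet, Set.compl_iInter]
  refine (measureReal_iUnion_fintype_le _).trans ?_
  rw [← nsmul_eq_mul]
  exact Finset.sum_le_card_nsmul _ _ _ fun i _ => stdSample_not_nearIsometry_le hn (u i) (v i) hx

/-- Union bound over pairs of net points: e⁵ ≥ 50 beats 25 and leaves 2^{-p} ≤ 1/p. -/
lemma pow_mul_exp_neg_le (hp : 0 < p) : (5 ^ p * 5 ^ p : ℝ) * (4 * Real.exp (-(5 * p))) ≤ 4 / p := by
  have hp' : (0 : ℝ) < p := by exact_mod_cast hp
  have h1 : (50 : ℝ) ≤ Real.exp 5 := by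
    have h2 : (5 : ℝ) / 2 ≤ Real.exp 1 := by linarith [Real.exp_one_gt_d9]
    have h3 : Real.exp 5 = Real.exp 1 ^ 5 := by rw [← Real.exp_nat_mul]; norm_num
    rw [h3]
    exact le_trans (by norm_num) (pow_le_pow_left₀ (by norm_num) h2 5)
  have h4 : Real.exp (-(5 * p)) ≤ ((50 : ℝ) ^ p)⁻¹ := by
    rw [Real.exp_neg, mul_comm, Real.exp_nat_mul]
    exact inv_anti₀ (by positivity) (pow_le_pow_left₀ (by norm_num) h1 p)
  have h5 : (p : ℝ) ≤ 2 ^ p := by exact_mod_cast Nat.lt_two_pow_self.le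
  have h6 : (50 : ℝ) ^ p = 2 ^ p * (5 ^ p * 5 ^ p) := by
    rw [← mul_pow, ← mul_pow]
    norm_num
  calc (5 ^ p * 5 ^ p : ℝ) * (4 * Real.exp (-(5 * p)))
      ≤ (5 ^ p * 5 ^ p : ℝ) * (4 * ((50 : ℝ) ^ p)⁻¹) := by gcongr
    _ = 4 / 2 ^ p := by
        rw [h6]
        field_simp
    _ ≤ 4 / p := by gcongr

lemma stdSample_goodSet_compl_le (hn : 0 < n) (hp : 0 < p) (z e : Fin p → H)
    {N : Finset (EuclideanSpace ℝ (Fin p))} (hN : N.card ≤ 5 ^ p) :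
    (stdSample n H).real (goodSet n G z e N (chiDev n (5 * Real.log p) / n)
      (chiDev n (5 * p) / n))ᶜ ≤ 20 / p := by
  have hp' : (0 : ℝ) < p := by exact_mod_cast hp
  have hp1 : (1 : ℝ) ≤ p := by exact_mod_cast hp
  have hL : 0 ≤ 5 * Real.log p := mul_nonneg (by norm_num) (Real.log_natCast_nonneg p)
  have hexp : Real.exp (-(5 * Real.log p)) = ((p : ℝ) ^ 5)⁻¹ := by
    rw [Real.exp_neg, show (5 : ℝ) * Real.log p = (5 : ℕ) * Real.log p by norm_num,
      Real.exp_nat_mul, Real.exp_log hp']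
  -- The largest polynomial family is indexed by quadruples; the exponent 5 leaves a factor 1/p.
  have key : ∀ k : ℕ, k ≤ 4 → (p : ℝ) ^ k * (4 * Real.exp (-(5 * Real.log p))) ≤ 4 / p := by
    intro k hk
    rw [hexp]
    calc (p : ℝ) ^ k * (4 * ((p : ℝ) ^ 5)⁻¹) ≤ (p : ℝ) ^ 4 * (4 * ((p : ℝ) ^ 5)⁻¹) := by
          gcongr
      _ = 4 / p := by field_simp
  simp only [goodSet, Set.compl_inter]
  have b5 : (stdSample n H).real (nearIsometrySet n (chiDev n (5 * p) / n)
      (fun i : N × N => ∑ a, i.1.1 a • e a) (fun i => ∑ a, i.2.1 a • e a))ᶜ ≤ 4 / p := by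
    refine (stdSample_nearIsometrySet_compl_le hn _ _ (by positivity)).trans
      (le_trans ?_ (pow_mul_exp_neg_le hp))
    gcongr
    rw [Fintype.card_prod, Fintype.card_coe, Nat.cast_mul]
    have : (N.card : ℝ) ≤ 5 ^ p := by exact_mod_cast hN
    gcongr
  have b : ∀ {ι : Type} [Fintype ι] (u v : ι → H) (k : ℕ), k ≤ 4 → Fintype.card ι = p ^ k →
      (stdSample n H).real (nearIsometrySet n (chiDev n (5 * Real.log p) / n) u v)ᶜ ≤ 4 / p := by
    intro ι _ u v k hk hcard
    refine (stdSample_nearIsometrySet_compl_le hn _ _ hL).trans (le_trans ?_ (key k hk))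
    rw [hcard, Nat.cast_pow]
  refine (measureReal_union_le _ _).trans ((add_le_add ((measureReal_union_le _ _).trans
    (add_le_add ((measureReal_union_le _ _).trans (add_le_add ((measureReal_union_le _ _).trans
      (add_le_add (b _ _ 4 le_rfl ?_) (b _ _ 2 (by norm_num) ?_))) (b _ _ 3 (by norm_num) ?_)))
      (b _ _ 2 (by norm_num) ?_))) b5).trans (le_of_eq ?_))
  any_goals
    simp only [Fintype.card_prod, Fintype.card_fin]
    ring
  ring

end GoodEvent

/-! ### Numerical constants and conclusion. -/

section Main

lemma chiDev_div {n x : ℝ} (hn : 0 < n) : chiDev n x / n = √(8 * (x / n)) + 16 * (x / n) := by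
  have : √(8 * n * x) / n = √(8 * (x / n)) := by
    nth_rewrite 2 [← Real.sqrt_sq hn.le]
    rw [← Real.sqrt_div' _ (sq_nonneg n)]
    congr 1
    field_simp
  rw [chiDev, add_div, this, mul_div_assoc]

/-- The bound on `L / n` makes the linear part subordinate: 80 (L/n) ≤ (80/100) √(L/n), and √40 +
0.8 < 8. It also yields δ ≤ 8/100 < 1/10. -/
lemma chiDev_log_le {n L : ℝ} (hn : 0 < n) (hL : 0 ≤ L) (hLn : L ≤ 1 / 10000 * n) :
    chiDev n (5 * L) / n ≤ 8 * √(L / n) ∧ √(L / n) ≤ 1 / 100 := by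
  have h0 : 0 ≤ L / n := by positivity
  have h1 : √(L / n) ≤ 1 / 100 := by
    rw [Real.sqrt_le_left (by norm_num), div_le_iff₀ hn]
    linarith
  refine ⟨?_, h1⟩
  have h2 : √(8 * (5 * L / n)) ≤ 7 * √(L / n) := by
    rw [show 8 * (5 * L / n) = 40 * (L / n) by ring, Real.sqrt_le_left (by positivity), mul_pow,
      Real.sq_sqrt h0]
    linarith
  rw [chiDev_div hn, show 16 * (5 * L / n) = 80 * (L / n) by ring]
  nlinarith [Real.sq_sqrt h0, Real.sqrt_nonneg (L / n)]

/-- The coefficients that arise (50·64; 84·8 + 13·8, 4·7, 4·80) are all dominated by 20000,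
respectively 20000/8. Strictness comes from `0 < Δ`, since γ may be 0. -/
lemma separation_bounds {n m p L γ Δ δ ε : ℝ} (hn : 0 < n) (hm : 1 ≤ m) (hp : 0 ≤ p) (hL : 0 ≤ L)
    (hγ : 0 ≤ γ) (hΔ : 0 < Δ) (hδ0 : 0 ≤ δ) (hδ : δ ≤ 8 * √(L / n)) (hε : ε = chiDev n (5 * p) / n)
    (h : 20000 * γ * (√(L / (m * n)) + √(p / (n * m ^ 2)) + L / n + p / (n * m)) ≤ Δ) :
    50 * (δ ^ 2 * γ) ≤ Δ ∧
      6 * (14 * (δ * γ) / √m) + (4 * (ε * γ) + 13 * (δ * γ)) / m < Δ / 8 := by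
  have hm0 : 0 < m := by linarith
  have hℓ : 0 ≤ L / n := by positivity
  have hsm : 0 < √m := Real.sqrt_pos.2 hm0
  have hsm' : √m ≤ m := by
    rw [Real.sqrt_le_left hm0.le]
    nlinarith
  have t1 : √(L / (m * n)) = √(L / n) / √m := by
    rw [← Real.sqrt_div' _ hm0.le]
    congr 1
    field_simp
  have t2 : √(p / (n * m ^ 2)) = √(p / n) / m := by
    rw [← div_div, Real.sqrt_div' _ (sq_nonneg m), Real.sqrt_sq hm0.le]
  have t4 : p / (n * m) = p / n / m := by rw [div_div]
  rw [t1, t2, t4] at h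
  set a := √(L / n) / √m
  set b := √(p / n) / m
  set c := p / n / m
  have ha : 0 ≤ a := by positivity
  have hb : 0 ≤ b := by positivity
  have hc : 0 ≤ c := by positivity
  have hsum : γ * a + γ * b + γ * (L / n) + γ * c ≤ Δ / 20000 := by linarith
  have ga := mul_nonneg hγ ha
  have gb := mul_nonneg hγ hb
  have gc := mul_nonneg hγ hc
  have gl := mul_nonneg hγ hℓ
  constructor
  · have : δ ^ 2 ≤ 64 * (L / n) := by
      calc δ ^ 2 ≤ (8 * √(L / n)) ^ 2 := pow_le_pow_left₀ hδ0 hδ 2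
        _ = 64 * (L / n) := by rw [mul_pow, Real.sq_sqrt hℓ]; norm_num
    nlinarith [mul_le_mul_of_nonneg_left this hγ]
  · have e1 : δ * γ / √m ≤ 8 * (γ * a) := by
      rw [div_le_iff₀ hsm]
      calc δ * γ ≤ 8 * √(L / n) * γ := mul_le_mul_of_nonneg_right hδ hγ
        _ = 8 * (γ * a) * √m := by simp only [a]; field_simp
    have e2 : δ * γ / m ≤ 8 * (γ * a) :=
      (div_le_div_of_nonneg_left (mul_nonneg hδ0 hγ) hsm hsm').trans e1
    have e3 : ε * γ / m ≤ 7 * (γ * b) + 80 * (γ * c) := by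
      have hs : √(8 * (5 * p / n)) ≤ 7 * √(p / n) := by
        rw [show 8 * (5 * p / n) = 40 * (p / n) by ring, Real.sqrt_le_left (by positivity), mul_pow,
          Real.sq_sqrt (by positivity)]
        have : 0 ≤ p / n := by positivity
        linarith
      rw [hε, chiDev_div hn, div_le_iff₀ hm0]
      calc (√(8 * (5 * p / n)) + 16 * (5 * p / n)) * γ
          ≤ (7 * √(p / n) + 16 * (5 * p / n)) * γ := by gcongr
        _ = (7 * (γ * b) + 80 * (γ * c)) * m := by simp only [b, c]; field_simp; ring
    have e4 : 6 * (14 * (δ * γ) / √m) + (4 * (ε * γ) + 13 * (δ * γ)) / m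
        = 84 * (δ * γ / √m) + 4 * (ε * γ / m) + 13 * (δ * γ / m) := by ring
    rw [e4]
    linarith

/-- Continuous images of closed sets need not be Borel, but those of σ-compact sets are again
σ-compact; this makes the image of the good event measurable. -/
lemma measurableSet_of_isSigmaCompact {X : Type*} [TopologicalSpace X] [T2Space X]
    [MeasurableSpace X] [OpensMeasurableSpace X] {s : Set X} (hs : IsSigmaCompact s) :
    MeasurableSet s := by
  obtain ⟨K, hK, rfl⟩ := hs
  exact MeasurableSet.iUnion fun i => (hK i).measurableSet

variable {n p : ℕ} {G : Partition p}

lemma eq_partnership_of_mem_goodSet {H : Type*} [NormedAddCommGroup H] [InnerProductSpace ℝ H]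
    {z e : Fin p → H} {γ Δ : ℝ} (h : LatentVectors G z e γ)
    (hsep : ∀ a b, group G a ≠ group G b → Δ ≤ ‖z a - z b‖ ^ 2) (hn : 0 < n) (hp : 0 < p)
    (hm : 3 ≤ minSize G) (hΔ : 0 < Δ) (hLn : Real.log p ≤ 1 / 10000 * n)
    (hlow : 20000 * γ * (√(Real.log p / (minSize G * n)) + √(p / (n * (minSize G : ℝ) ^ 2))
      + Real.log p / n + p / (n * minSize G)) ≤ Δ)
    {N : Finset (EuclideanSpace ℝ (Fin p))} (hN1 : ∀ v ∈ N, ‖v‖ ≤ 1)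
    (hN : ∀ u, ‖u‖ ≤ 1 → ∃ v ∈ N, ‖u - v‖ ≤ 1 / 2) {ξ : Fin n → H}
    (hξ : ξ ∈ goodSet n G z e N (chiDev n (5 * Real.log p) / n) (chiDev n (5 * p) / n))
    {D : Matrix (Fin n) (Fin p) ℝ} (hD : ∀ i a, D i a = ⟪z a + e a, ξ i⟫)
    {B : Matrix (Fin p) (Fin p) ℝ} (hB : IsPecokOutput G.parts.card D B) : B = partnership G := by
  have hn' : (0 : ℝ) < n := by exact_mod_cast hn
  have hm' : (1 : ℝ) ≤ minSize G := by exact_mod_cast (by omega : 1 ≤ minSize G)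
  have hL : 0 ≤ Real.log p := Real.log_natCast_nonneg p
  obtain ⟨hδ, hℓ⟩ := chiDev_log_le hn' hL hLn
  have hδ0 : 0 ≤ chiDev n (5 * Real.log p) / n := by unfold chiDev; positivity
  have hε0 : 0 ≤ chiDev n (5 * p) / n := by unfold chiDev; positivity
  obtain ⟨hΔ1, hΔ2⟩ := separation_bounds hn' hm' p.cast_nonneg hL (h.nonneg ⟨0, hp⟩) hΔ hδ0 hδ rfl
    hlow
  obtain ⟨⟨⟨⟨h1, h2⟩, h3⟩, h4⟩, h5⟩ := hξ
  rw [mem_nearIsometrySet] at h1 h2 h3 h4 h5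
  refine eq_partnership_of_isPecokOutput (T := empiricalMap ξ) hn hp (fun a b => ?_) h hm hδ0
    (hδ.trans (by linarith)) (fun a b c d => h1 ((a, b), c, d)) (fun a b => h2 (a, b))
    (fun a b c => h3 ((a, b), c)) (fun a b => h4 (a, b)) hε0 hN1 hN
    (fun u hu v hv => h5 (⟨u, hu⟩, ⟨v, hv⟩)) hΔ hsep hΔ1 hΔ2 hB
  rw [inner_empiricalMap, sampleCov, Matrix.smul_apply, mul_apply, smul_eq_mul]
  simp only [transpose_apply, hD]

/-- PECOK recovers the partnership matrix with high probability. -/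
theorem measure_ne_partnership_le {Ω Ω₀ : Type*} [MeasurableSpace Ω] [MeasurableSpace Ω₀]
    {P : Measure Ω} [IsProbabilityMeasure P] {P₀ : Measure Ω₀} [IsProbabilityMeasure P₀]
    {X₀ : Ω₀ → Fin p → ℝ} {Z : Ω₀ → G.parts → ℝ} {E : Ω₀ → Fin p → ℝ}
    (hX₀ : HasGaussianLaw X₀ P₀) (h : LatentDecomposition P₀ G X₀ Z E) (hn : 0 < n) (hp : 0 < p)
    (hm : 3 ≤ minSize G) (hΔ : 0 < separation (covMatrix Z P₀))
    {X : Fin n → Ω → Fin p → ℝ} (hind : iIndepFun X P) (hid : ∀ i, IdentDistrib (X i) X₀ P P₀)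
    (hLn : Real.log p ≤ 1 / 10000 * n)
    (hlow : 20000 * supNorm (covMatrix E P₀) * (√(Real.log p / (minSize G * n)) +
      √(p / (n * (minSize G : ℝ) ^ 2)) + Real.log p / n + p / (n * minSize G))
        ≤ separation (covMatrix Z P₀))
    {Bhat : Ω → Matrix (Fin p) (Fin p) ℝ}
    (hB : ∀ ω, IsPecokOutput G.parts.card (dataMatrix X ω) (Bhat ω)) :
    P {ω | Bhat ω ≠ partnership G} ≤ ENNReal.ofReal (20 / p) := by
  obtain ⟨q, z, e, hv, hsep, hcov⟩ := h.exists_latentVectors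
  obtain ⟨N, hNcard, hN1, hN⟩ := exists_half_net (EuclideanSpace ℝ (Fin p))
  rw [finrank_euclideanSpace_fin] at hNcard
  set good := goodSet n G z e N (chiDev n (5 * Real.log p) / n) (chiDev n (5 * p) / n) with hgood
  set Φ : (Fin n → EuclideanSpace ℝ (Fin q)) → Fin n → Fin p → ℝ :=
    fun ξ i a => ⟪z a + e a, ξ i⟫ with hΦ
  have hΦc : Continuous Φ := by fun_prop
  have hmeas : MeasurableSet (Φ '' good)ᶜ :=
    (measurableSet_of_isSigmaCompact ((isSigmaCompact_univ.of_isClosed_subset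
      (isClosed_goodSet _ _ _ _ _) (Set.subset_univ _)).image hΦc)).compl
  have haem : ∀ i, AEMeasurable (X i) P := fun i => (hid i).aemeasurable_fst
  have hlaw : P.map (fun ω i => X i ω) = (stdSample n (EuclideanSpace ℝ (Fin q))).map Φ := by
    rw [(iIndepFun_iff_map_fun_eq_pi_map haem).1 hind]
    have hrow := map_eq_map_stdGaussian hX₀ h.mean hcov
    have hmap : ∀ i, P.map (X i) = (stdGaussian (EuclideanSpace ℝ (Fin q))).map
        (fun y a => ⟪z a + e a, y⟫) := fun i => (hid i).map_eq.trans hrow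
    simp only [hmap]
    have : IsProbabilityMeasure ((stdGaussian (EuclideanSpace ℝ (Fin q))).map
        (fun y (a : Fin p) => ⟪z a + e a, y⟫)) :=
      Measure.isProbabilityMeasure_map (by fun_prop)
    exact (Measure.pi_map_pi fun i => by fun_prop).symm
  -- The sample ξ does not live on `Ω`; only the law of the data is shared. If the data lie in `Φ ''
  -- good`, some good ξ produces them and the deterministic theorem applies. Monotonicity of `P`
  -- requires no measurability of `Bhat`.
  calc P {ω | Bhat ω ≠ partnership G} ≤ P ((fun ω i => X i ω) ⁻¹' (Φ '' good)ᶜ) := by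
        refine measure_mono fun ω hω hmem => hω ?_
        obtain ⟨ξ, hξ, hξω⟩ := hmem
        refine eq_partnership_of_mem_goodSet hv hsep hn hp hm hΔ hLn hlow hN1 hN hξ
          (fun i a => ?_) (hB ω)
        exact (congrFun (congrFun hξω i) a).symm
    _ = (stdSample n (EuclideanSpace ℝ (Fin q))) (Φ ⁻¹' (Φ '' good)ᶜ) := by
        rw [← Measure.map_apply_of_aemeasurable (aemeasurable_pi_lambda _ haem) hmeas, hlaw,
          Measure.map_apply hΦc.measurable hmeas]
    _ ≤ (stdSample n (EuclideanSpace ℝ (Fin q))) goodᶜ :=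
        measure_mono fun ξ hξ hmem => hξ (Set.mem_image_of_mem Φ hmem)
    _ ≤ ENNReal.ofReal (20 / p) := by
        rw [← ofReal_measureReal]
        exact ENNReal.ofReal_le_ofReal (stdSample_goodSet_compl_le hn hp z e hNcard)

end Main

end Pecok

theorem mainTheorem2 :
    ∃ c₁ c₂ c₃ : ℝ, 0 < c₁ ∧ 0 < c₂ ∧ 0 < c₃ ∧
      ∀ {n p : ℕ} {Ω Ω₀ : Type*} [MeasurableSpace Ω] [MeasurableSpace Ω₀]
        (P : Measure Ω) [IsProbabilityMeasure P] (P₀ : Measure Ω₀) [IsProbabilityMeasure P₀]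
        -- the true partition and the generic centered Gaussian vector with its latent decomposition
        (G : Pecok.Partition p) (X₀ : Ω₀ → Fin p → ℝ)
        (Z : Ω₀ → G.parts → ℝ) (E : Ω₀ → Fin p → ℝ),
        HasGaussianLaw X₀ P₀ →
        Pecok.LatentDecomposition P₀ G X₀ Z E →
        2 ≤ G.parts.card →
        3 ≤ Pecok.minSize G →
        0 < Pecok.separation (Pecok.covMatrix Z P₀) →
        -- the `n` i.i.d. observations
        ∀ (X : Fin n → Ω → Fin p → ℝ),
        iIndepFun X P →
        (∀ i, IdentDistrib (X i) X₀ P P₀) →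
        Real.log p ≤ c₁ * n →
        c₂ * Pecok.supNorm (Pecok.covMatrix E P₀) *
            (√(Real.log p / (Pecok.minSize G * n)) + √(p / (n * (Pecok.minSize G : ℝ) ^ 2))
              + Real.log p / n + p / (n * Pecok.minSize G))
          ≤ Pecok.separation (Pecok.covMatrix Z P₀) →
        -- the estimator of Steps 1 and 2
        ∀ (Bhat : Ω → Matrix (Fin p) (Fin p) ℝ),
        (∀ ω, Pecok.IsPecokOutput G.parts.card (Pecok.dataMatrix X ω) (Bhat ω)) →
        P {ω | Bhat ω ≠ Pecok.partnership G} ≤ ENNReal.ofReal (c₃ / p) ∧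
        -- Step 3, for any (possibly randomized) clustering algorithm that maps `B*` to `G*`
        ∀ (cluster : Ω → Matrix (Fin p) (Fin p) ℝ → Pecok.Partition p),
        (∀ᵐ ω ∂P, cluster ω (Pecok.partnership G) = G) →
        P {ω | cluster ω (Bhat ω) ≠ G} ≤ ENNReal.ofReal (c₃ / p) := by
  refine ⟨1 / 10000, 20000, 20, by norm_num, by norm_num, by norm_num, ?_⟩
  intro n p Ω Ω₀ _ _ P _ P₀ _ G X₀ Z E hX₀ h hK hm hΔ X hind hid hLn hlow Bhat hB
  have hp : 2 ≤ p := hK.trans (by simpa using G.card_parts_le_card)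
  have hn : 0 < n := by
    -- For n = 0 the bound on log p would force log p ≤ 0, contradicting p ≥ 2.
    rcases Nat.eq_zero_or_pos n with rfl | hn
    · have : 0 < Real.log p := Real.log_pos (by exact_mod_cast hp)
      rw [Nat.cast_zero, mul_zero] at hLn
      linarith
    · exact hn
  have hmain := Pecok.measure_ne_partnership_le hX₀ h hn (by omega) hm hΔ hind hid hLn hlow hB
  refine ⟨hmain, fun cluster hcluster => (measure_mono_ae ?_).trans hmain⟩
  filter_upwards [hcluster] with ω hω hne heq
  exact hne (by rw [heq, hω])
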